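/- **Setting.** Let $\mathcal A$ be a set of particles and $\mathcal L=(L(\alpha,\beta))_{\alpha,\beta\in\mathcal A}$ a real symmetric matrix with finitely many non-zero entries in each row and $\mathcal L>0$ on $l^2(\mathcal A)$. Let $\mathcal C$ be a finite set of channels $\sigma=\{\sigma(k)\}_{k\ge 0}\subset\mathcal A$, with all particles $\sigma(k)$ ($\sigma\in\mathcal C$, $k\ge 0$) distinct, such that only finitely many particles are not of the form $\sigma(k)$, $k\ge1$, and such that for $k\ge 1$ the particle $\sigma(k)$ interacts only with $\sigma(k\pm1)$ and itself. Put $\mathfrak a_\sigma(k)=L(\sigma(k),\sigma(k))$, $\mathfrak b_\sigma(k)=-L(\sigma(k),\sigma(k+1))$ and assume $\mathfrak b_\sigma(k)>0$ and that there are $a_\sigma\in\mathbb R$, $b_\sigma>0$ and $\epsilon>0$ with $\sum_k(1+\epsilon)^k(|\mathfrak a_\sigma(k)-a_\sigma|+|\mathfrak b_\sigma(k)-b_\sigma|)<\infty$. Assume that $\bigcup_\sigma(a_\sigma-2b_\sigma,a_\sigma+2b_\sigma)$ is connected, and let $[a-2b,a+2b]=\bigcup_\sigma[a_\sigma-2b_\sigma,a_\sigma+2b_\sigma]$.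 Let $W(\omega)=a-b(\omega+\omega^{-1})$, $W_\sigma(\theta)=a_\sigma-b_\sigma(\theta+\theta^{-1})$, and let $\theta_\sigma=W_\sigma^{-1}\circ W$ on the unit disk $\mathbb D$, extended by continuity to the unit circle $\mathbb T$; let $T_\sigma^+=\{\omega\in\mathbb T:|\theta_\sigma(\omega)|=1\}$. For $0<|\theta|\le1$ let $e_\sigma(k,\theta)$, $k\ge0$, be the Jost solution: the solution of $-\mathfrak b_\sigma(k-1)x(k-1)+\mathfrak a_\sigma(k)x(k)-\mathfrak b_\sigma(k)x(k+1)=W_\sigma(\theta)x(k)$, $k\ge1$, with $e_\sigma(k,\theta)=\theta^k(1+o(1))$ as $k\to\infty$. Call $\omega$ with $0<|\omega|\le1$ *regular* if the equation $\mathcal L\xi=W(\omega)\xi$ has no non-zero solution $\xi$ on $\mathcal A$ that is a multiple of $e_\gamma(\cdot,\theta_\gamma(\omega))$ along every channel $\gamma$, and *exceptional* otherwise. For $\omega$ regular, the special solution $\psi^\sigma(\cdot,\omega)$ is the solution of $\mathcal L\psi=W(\omega)\psi$ on $\mathcal A$ such that $\psi^\sigma(\gamma(k),\omega)=s_{\gamma\sigma}(\omega)e_\gamma(k,\theta_\gamma(\omega))$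 for $\gamma\ne\sigma$, and such that $\psi^\sigma(\sigma(k),\omega)=e_\sigma(k,\theta_\sigma(\omega)^{-1})+s_{\sigma\sigma}(\omega)e_\sigma(k,\theta_\sigma(\omega))$ if $|\theta_\sigma(\omega)|=1$, and $\psi^\sigma(\sigma(k),\omega)=\theta_\sigma(\omega)^{-k}(1+o(1))$ as $k\to\infty$ if $|\theta_\sigma(\omega)|<1$. This defines the scattering coefficients $s_{\gamma\sigma}(\omega)$, $\gamma\neq\sigma$, at regular points. At an exceptional point $\omega\in\mathbb T$, $s_{\gamma\sigma}(\omega)$ is the limit of $s_{\gamma\sigma}(w)$ as $w\to\omega$ through the regular points $w\in\mathbb D\setminus\{0\}$, with the convention $s_{\gamma\sigma}(\omega)=0$ if this limit does not exist. **Corollary.** Let $\sigma,\nu\in\mathcal C$, $\sigma\ne\nu$, and $\omega\in T_\sigma^+\cup T_\nu^+$. If $\omega$ is regular, or if $W(\omega)$ is not one of the band edges $a_\gamma\pm2b_\gamma$, $\gamma\in\mathcal C$, then $s_{\nu\sigma}(\omega)$ is well defined: at a regular point the special solution exists and its coefficient $s_{\nu\sigma}(\omega)$ is unique, and at an exceptional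 point the limit exists. For every $\omega\in T_\sigma^+\cup T_\nu^+$, $$s_{\nu\sigma}(\omega^{-1})=\overline{s_{\nu\sigma}(\omega)},\qquad |s_{\nu\sigma}(\omega)|^2=s_{\nu\sigma}(\omega)\,s_{\nu\sigma}(\omega^{-1}).$$ -/

import Mathlib

/-- The element selected by a predicate that at most one element satisfies; `0` if there is none. -/
noncomputable def theOrZero {X : Type*} [Zero X] (P : X → Prop) : X :=
  open Classical in if h : ∃ x, P x then h.choose else 0

/-- A system of particles `A` with finitely many semi-infinite channels (indexed by `C`) attached
to a finite central part.  The particles of the channel `σ` are `chan σ 0, chan σ 1, …`;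
the attachment point `chan σ 0` belongs to the central part. -/
structure WebSystem (A C : Type*) where
  /-- the interaction matrix -/
  L : A → A → ℝ
  symm : ∀ α β, L α β = L β α
  finite_row : ∀ α, {β | L α β ≠ 0}.Finite
  /-- strict positivity as a quadratic form on `l²(A)` -/
  pos : ∀ ξ : A → ℝ, Summable (fun α => ξ α ^ 2) → ξ ≠ 0 →
    0 < ∑' α, (∑ᶠ β, L α β * ξ β) * ξ α
  /-- the particles of the channels -/
  chan : C → ℕ → A
  chan_injective : Function.Injective (fun p : C × ℕ => chan p.1 p.2)
  finite_center : {α : A | ∀ σ k, α ≠ chan σ (k + 1)}.Finite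
  chan_local : ∀ σ k β, L (chan σ (k + 1)) β ≠ 0 →
    β = chan σ k ∨ β = chan σ (k + 1) ∨ β = chan σ (k + 2)
  off_diag_neg : ∀ σ k, L (chan σ k) (chan σ (k + 1)) < 0
  /-- limits of the diagonal coefficients along the channels -/
  aLim : C → ℝ
  /-- limits of (minus) the off-diagonal coefficients along the channels -/
  bLim : C → ℝ
  bLim_pos : ∀ σ, 0 < bLim σ
  decay : ∃ ε : ℝ, 0 < ε ∧ ∀ σ, Summable (fun k : ℕ => (1 + ε) ^ k *
    (|L (chan σ k) (chan σ k) - aLim σ| + |-L (chan σ k) (chan σ (k + 1)) - bLim σ|))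
  connected_bands : IsPreconnected
    (⋃ σ, Set.Ioo (aLim σ - 2 * bLim σ) (aLim σ + 2 * bLim σ))

namespace WebSystem

/-- The diagonal coefficients `𝔞_σ(k)` along a channel. -/
def diag {A C : Type*} (S : WebSystem A C) (σ : C) (k : ℕ) : ℝ :=
  S.L (S.chan σ k) (S.chan σ k)

/-- The coefficients `𝔟_σ(k) = -L(σ(k), σ(k+1))`. -/
def offDiag {A C : Type*} (S : WebSystem A C) (σ : C) (k : ℕ) : ℝ :=
  -S.L (S.chan σ k) (S.chan σ (k + 1))

/-- Lower end `a - 2b` of the union of all bands `[a_σ - 2b_σ, a_σ + 2b_σ]`. -/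
noncomputable def lower {A C : Type*} (S : WebSystem A C) : ℝ := ⨅ σ, (S.aLim σ - 2 * S.bLim σ)

/-- Upper end `a + 2b` of the union of all bands. -/
noncomputable def upper {A C : Type*} (S : WebSystem A C) : ℝ := ⨆ σ, (S.aLim σ + 2 * S.bLim σ)

/-- The midpoint `a` of `[a - 2b, a + 2b]`. -/
noncomputable def a {A C : Type*} (S : WebSystem A C) : ℝ := (S.lower + S.upper) / 2

/-- A quarter `b` of the length of `[a - 2b, a + 2b]`. -/
noncomputable def b {A C : Type*} (S : WebSystem A C) : ℝ := (S.upper - S.lower) / 4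

/-- The spectral parameter `λ(ω) = W(ω) = a - b (ω + ω⁻¹)`. -/
noncomputable def W {A C : Type*} (S : WebSystem A C) (ω : ℂ) : ℂ :=
  S.a - S.b * (ω + ω⁻¹)

/-- `W_σ(θ) = a_σ - b_σ (θ + θ⁻¹)`. -/
noncomputable def Wchan {A C : Type*} (S : WebSystem A C) (σ : C) (θ : ℂ) : ℂ :=
  S.aLim σ - S.bLim σ * (θ + θ⁻¹)

/-- `θ_σ(ω) = W_σ⁻¹(W(ω))` for `0 < |ω| ≤ 1`.  For `0 < |ω| < 1` it is the only point of the open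
unit disk with `W_σ(θ) = W(ω)`.  For `|ω| = 1` it is the boundary value from inside the disk:
`W` and `W_σ` preserve the sign of the imaginary part inside the disk, so that, of the two
solutions `θ` and `θ⁻¹ = conj θ` on the unit circle (if they are there), it is the one on the same
side of the real axis as `ω`. -/
noncomputable def theta {A C : Type*} (S : WebSystem A C) (σ : C) (ω : ℂ) : ℂ :=
  theOrZero fun θ : ℂ => θ ≠ 0 ∧ ‖θ‖ ≤ 1 ∧ S.Wchan σ θ = S.W ω ∧ 0 ≤ θ.im * ω.im

/-- The part `T_σ⁺` of the unit circle that `θ_σ` maps to the unit circle. -/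
def Tplus {A C : Type*} (S : WebSystem A C) (σ : C) : Set ℂ :=
  {ω | ‖ω‖ = 1 ∧ ‖S.theta σ ω‖ = 1}

/-- The Jost solution on the channel `σ` at `θ`, `0 < |θ| ≤ 1`: the only solution of the
three-term recurrence along the channel which is `θ^k (1 + o(1))` as `k → ∞`. -/
def IsJost {A C : Type*} (S : WebSystem A C) (σ : C) (θ : ℂ) (x : ℕ → ℂ) : Prop :=
  (∀ k : ℕ, -(S.offDiag σ k : ℂ) * x k + S.diag σ (k + 1) * x (k + 1)
      - S.offDiag σ (k + 1) * x (k + 2) = S.Wchan σ θ * x (k + 1)) ∧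
  Filter.Tendsto (fun k : ℕ => x k / θ ^ k) Filter.atTop (nhds 1)

/-- The Jost solution `e_σ(k, θ)`. -/
noncomputable def jost {A C : Type*} (S : WebSystem A C) (σ : C) (k : ℕ) (θ : ℂ) : ℂ :=
  theOrZero (S.IsJost σ θ) k

/-- `ξ` satisfies `L ξ = lam ξ` on all of `A` (no growth condition). -/
def IsSolution {A C : Type*} (S : WebSystem A C) (lam : ℂ) (ξ : A → ℂ) : Prop :=
  ∀ α, ∑ᶠ β, (S.L α β : ℂ) * ξ β = lam * ξ α

/-- `ω` is regular if the equation with `λ = λ(ω)` has no non-zero solution which on every channel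
is a multiple of the Jost solution; the other points are exceptional. -/
def IsRegular {A C : Type*} (S : WebSystem A C) (ω : ℂ) : Prop :=
  ∀ ξ : A → ℂ, S.IsSolution (S.W ω) ξ →
    (∀ γ, ∃ c : ℂ, ∀ k, ξ (S.chan γ k) = c * S.jost γ k (S.theta γ ω)) → ξ = 0

/-- `ψ` is (at the point `ω`) the special solution which corresponds to the channel `σ`, with
coefficients `s γ = s_{γσ}(ω)` along the channels.  If `|θ_σ(ω)| < 1`, the value `s σ` plays no
role. -/
structure IsSpecialSolution {A C : Type*} (S : WebSystem A C) (σ : C) (ω : ℂ)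
    (ψ : A → ℂ) (s : C → ℂ) : Prop where
  solution : S.IsSolution (S.W ω) ψ
  outgoing : ∀ γ, γ ≠ σ → ∀ k, ψ (S.chan γ k) = s γ * S.jost γ k (S.theta γ ω)
  incoming : ‖S.theta σ ω‖ = 1 → ∀ k, ψ (S.chan σ k) =
    S.jost σ k (S.theta σ ω)⁻¹ + s σ * S.jost σ k (S.theta σ ω)
  growing : ‖S.theta σ ω‖ < 1 →
    Filter.Tendsto (fun k : ℕ => ψ (S.chan σ k) / (S.theta σ ω)⁻¹ ^ k) Filter.atTop (nhds 1)

/-- The coefficient `s_{νσ}(ω)` of the special solution at a regular point `ω`. -/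
noncomputable def regularCoeff {A C : Type*} (S : WebSystem A C) (ν σ : C) (ω : ℂ) : ℂ :=
  theOrZero fun z => ∃ ψ s, S.IsSpecialSolution σ ω ψ s ∧ s ν = z

/-- `z` is the value of the scattering coefficient `s_{νσ}`, `ν ≠ σ`, at `ω`.  At a regular point it
is the coefficient of the special solution; at an exceptional point it is the limit of these
coefficients from inside the disk. -/
def IsScatteringCoeff {A C : Type*} (S : WebSystem A C) (ν σ : C) (ω z : ℂ) : Prop :=
  (S.IsRegular ω ∧ ∃ ψ s, S.IsSpecialSolution σ ω ψ s ∧ s ν = z) ∨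
  (¬ S.IsRegular ω ∧ Filter.Tendsto (S.regularCoeff ν σ)
    (nhdsWithin ω {w | 0 < ‖w‖ ∧ ‖w‖ < 1 ∧ S.IsRegular w}) (nhds z))

/-- The scattering coefficient `s_{νσ}(ω)`, `ν ≠ σ` (with the value `0` at a pole). -/
noncomputable def scattering {A C : Type*} (S : WebSystem A C) (ν σ : C) (ω : ℂ) : ℂ :=
  theOrZero (S.IsScatteringCoeff ν σ ω)

/-- `λ(ω)` is an end point of the band `[a_γ - 2b_γ, a_γ + 2b_γ]` of some channel `γ`. -/
def IsBandEdge {A C : Type*} (S : WebSystem A C) (ω : ℂ) : Prop :=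
  ∃ γ, S.W ω = S.aLim γ - 2 * S.bLim γ ∨ S.W ω = S.aLim γ + 2 * S.bLim γ

end WebSystem

open Filter Topology

/-! The identities come from complex conjugation. The matrix `L` is real, so conjugation maps
solutions at `W ω` to solutions at `W (conj ω)`. Both `θ_γ` and the Jost solutions commute with it,
hence so do regularity, special solutions and boundary limits (`IsScatteringCoeff.conj`,
`scattering_conj`). On the unit circle `conj ω = ω⁻¹`, and the formula for `|s|²` is then `z * conj
z = |z|²`.

The harder claim is that the coefficient is well defined. Along a channel the equation is a
three-term recurrence, whose Jost solutions are built by a backward recursion that converges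
uniformly on the closed disk (`exists_backward_solution`, `exists_amplitude`). Expressing a function
by its Jost coefficients turns the outgoing problem into a square linear system on the finite
centre, `centerMap`. At a regular point this system is injective, hence surjective, which gives the
special solution (`exists_isSpecialSolution`).

At an exceptional boundary point off the band edges the limit system has a kernel. If `σ` is open,
meaning `|θ_σ(ω)| = 1`, Green's formula for an outgoing solution and its conjugate is a sum of terms
of one sign over the open channels, so kernel elements vanish there (`coeff_eq_zero_of_open`) and
decay on the closed ones. Inside the disk they are orthogonal to the special solution, because the
spectral parameters differ (`jostPairing_eq_zero`). Adding these orthogonality relations to the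
system makes the limit injective, and its solutions then converge (`exists_tendsto_of_injective`,
`exists_tendsto_regularCoeff`). If only `ν` is open, the limit is transferred from `s_{σν}` by
reciprocity, again a case of Green's formula (`regularCoeff_reciprocity`). -/

theorem theOrZero_spec {X : Type*} [Zero X] {P : X → Prop} (h : ∃ x, P x) : P (theOrZero P) := by
  classical
  unfold theOrZero
  rw [dif_pos h]
  exact h.choose_spec

theorem theOrZero_eq {X : Type*} [Zero X] {P : X → Prop} {x : X} (hx : P x)
    (huniq : ∀ y, P y → y = x) : theOrZero P = x :=
  huniq _ (theOrZero_spec ⟨x, hx⟩)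

theorem theOrZero_of_not_exists {X : Type*} [Zero X] {P : X → Prop} (h : ¬ ∃ x, P x) :
    theOrZero P = 0 := by
  unfold theOrZero
  rw [dif_neg h]

/-! ### Backward recursions with exponentially small perturbations -/

/-- One backward step for the pair `(y (k+1), y (k+1) - y (k+2))`. -/
def backStep (p q θ : ℂ) (v : ℂ × ℂ) : ℂ × ℂ :=
  (v.1 + (θ ^ 2 * v.2 + p * v.1 + q * (v.1 - v.2)), θ ^ 2 * v.2 + p * v.1 + q * (v.1 - v.2))

/-- The value at `k` of the solution of the backward recursion which starts from the constant
solution at `k + m`. -/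
def backIter (p q : ℕ → ℂ → ℂ) (θ : ℂ) : ℕ → ℕ → ℂ × ℂ
  | 0, _ => (1, 0)
  | m + 1, k => backStep (p k θ) (q k θ) θ (backIter p q θ m (k + 1))

theorem backStep_sub (p q θ : ℂ) (v w : ℂ × ℂ) :
    backStep p q θ v - backStep p q θ w = backStep p q θ (v - w) := by
  ext <;> simp [backStep] <;> ring

theorem continuous_backIter {p q : ℕ → ℂ → ℂ} (hp : ∀ k, Continuous (p k))
    (hq : ∀ k, Continuous (q k)) (m k : ℕ) : Continuous fun θ => backIter p q θ m k := by
  induction m generalizing k with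
  | zero => exact continuous_const
  | succ m ih =>
    have h1 := hp k
    have h2 := hq k
    have h3 := ih (k + 1)
    simp only [backIter, backStep]
    fun_prop

/-- The perturbation has size `s ^ k * s ^ k`. One factor is kept as a weight on the difference
component, the other makes the growth factor of the step summably close to `1`. No division by `1 -
θ ^ 2` occurs, so the estimate survives at `θ = ±1`. -/
theorem backStep_bound {p q θ : ℂ} {v : ℂ × ℂ} {K s a : ℝ} {k : ℕ} (hs0 : 0 < s) (hs1 : s < 1)
    (hK : 0 ≤ K) (hθ : ‖θ‖ ≤ 1) (hp : ‖p‖ ≤ K * (s ^ k * s ^ k)) (hq : ‖q‖ ≤ K * (s ^ k * s ^ k))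
    (h1 : ‖v.1‖ ≤ a) (h2 : ‖v.2‖ ≤ s ^ (k + 1) * a) :
    ‖(backStep p q θ v).1‖ ≤ (1 + (1 + 3 * K) * s ^ k) * a ∧
      ‖(backStep p q θ v).2‖ ≤ s ^ k * ((1 + (1 + 3 * K) * s ^ k) * a) := by
  have ha : 0 ≤ a := (norm_nonneg _).trans h1
  have ht0 : 0 < s ^ k := pow_pos hs0 k
  have ht1 : s ^ k ≤ 1 := pow_le_one₀ hs0.le hs1.le
  have h2' : ‖v.2‖ ≤ s ^ k * a := h2.trans (by
    rw [pow_succ]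
    have : s ^ k * s ≤ s ^ k := mul_le_of_le_one_right ht0.le hs1.le
    gcongr)
  have h2'' : ‖v.2‖ ≤ a := h2'.trans (mul_le_of_le_one_left ha ht1)
  have e1 : ‖θ ^ 2 * v.2‖ ≤ s ^ k * a := by
    rw [norm_mul, norm_pow]
    calc ‖θ‖ ^ 2 * ‖v.2‖ ≤ 1 * ‖v.2‖ := by gcongr; exact pow_le_one₀ (norm_nonneg _) hθ
      _ ≤ s ^ k * a := by rw [one_mul]; exact h2'
  have e2 : ‖p * v.1‖ ≤ K * (s ^ k * s ^ k) * a := by rw [norm_mul]; gcongr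
  have e3 : ‖q * (v.1 - v.2)‖ ≤ K * (s ^ k * s ^ k) * (a + a) := by
    rw [norm_mul]
    have := norm_sub_le v.1 v.2
    gcongr
    linarith
  have e4 : ‖θ ^ 2 * v.2 + p * v.1 + q * (v.1 - v.2)‖ ≤ s ^ k * ((1 + 3 * K * s ^ k) * a) := by
    have := norm_add₃_le (a := θ ^ 2 * v.2) (b := p * v.1) (c := q * (v.1 - v.2))
    linarith
  have e5 : s ^ k * (s ^ k * a) ≤ s ^ k * a :=
    mul_le_of_le_one_left (by positivity) ht1
  have e6 : K * (s ^ k * (s ^ k * a)) ≤ K * (s ^ k * a) := by gcongr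
  have e7 : 0 ≤ s ^ k * (s ^ k * a) := by positivity
  refine ⟨?_, ?_⟩
  · have := norm_add_le v.1 (θ ^ 2 * v.2 + p * v.1 + q * (v.1 - v.2))
    simp only [backStep]
    linarith
  · simp only [backStep]
    linarith

/-- Two approximants started at neighbouring points differ by `(p + q, p + q)` at the start, and by
linearity this error is carried by the same steps. The exponential bounds the product of the growth
factors `1 + (1 + 3K) s ^ j` over `j ≥ k`. -/
theorem backIter_bound {p q : ℕ → ℂ → ℂ} {K s : ℝ} {θ : ℂ} (hs0 : 0 < s) (hs1 : s < 1)
    (hK : 0 ≤ K) (hθ : ‖θ‖ ≤ 1) (hp : ∀ k, ‖p k θ‖ ≤ K * (s ^ k * s ^ k))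
    (hq : ∀ k, ‖q k θ‖ ≤ K * (s ^ k * s ^ k)) (m k : ℕ) :
    ‖(backIter p q θ (m + 1) k - backIter p q θ m k).1‖ ≤
        2 * K * s ^ (m + k) * Real.exp ((1 + 3 * K) * s ^ k / (1 - s)) ∧
      ‖(backIter p q θ (m + 1) k - backIter p q θ m k).2‖ ≤
        s ^ k * (2 * K * s ^ (m + k) * Real.exp ((1 + 3 * K) * s ^ k / (1 - s))) := by
  have hs : 0 < 1 - s := by linarith
  induction m generalizing k with
  | zero =>
    have ht0 : 0 < s ^ k := pow_pos hs0 k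
    have ht1 : s ^ k ≤ 1 := pow_le_one₀ hs0.le hs1.le
    have hG : 1 ≤ Real.exp ((1 + 3 * K) * s ^ k / (1 - s)) := Real.one_le_exp (by positivity)
    have h := norm_add_le_of_le (hp k) (hq k)
    have h3 : s ^ k * (2 * K * s ^ k) ≤
        s ^ k * (2 * K * s ^ k * Real.exp ((1 + 3 * K) * s ^ k / (1 - s))) := by
      exact mul_le_mul_of_nonneg_left (le_mul_of_one_le_right (by positivity) hG) ht0.le
    have h4 : s ^ k * (2 * K * s ^ k * Real.exp ((1 + 3 * K) * s ^ k / (1 - s))) ≤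
        2 * K * s ^ k * Real.exp ((1 + 3 * K) * s ^ k / (1 - s)) :=
      mul_le_of_le_one_left (by positivity) ht1
    simp only [backIter, backStep, zero_add, Prod.fst_sub, Prod.snd_sub, mul_zero, mul_one,
      sub_zero, add_sub_cancel_left]
    constructor <;> linarith
  | succ m ih =>
    obtain ⟨h1, h2⟩ := ih (k + 1)
    have h := backStep_bound hs0 hs1 hK hθ (hp k) (hq k) h1 h2
    rw [← backStep_sub] at h
    have key : (1 + (1 + 3 * K) * s ^ k) *
        (2 * K * s ^ (m + (k + 1)) * Real.exp ((1 + 3 * K) * s ^ (k + 1) / (1 - s))) ≤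
        2 * K * s ^ (m + 1 + k) * Real.exp ((1 + 3 * K) * s ^ k / (1 - s)) := by
      have e1 : (1 + 3 * K) * s ^ k / (1 - s) =
          (1 + 3 * K) * s ^ k + (1 + 3 * K) * s ^ (k + 1) / (1 - s) := by
        field_simp
        ring
      rw [e1, Real.exp_add, show m + (k + 1) = m + 1 + k by ring]
      have e2 : 1 + (1 + 3 * K) * s ^ k ≤ Real.exp ((1 + 3 * K) * s ^ k) := by
        linarith [Real.add_one_le_exp ((1 + 3 * K) * s ^ k)]
      calc _ = 2 * K * s ^ (m + 1 + k) * ((1 + (1 + 3 * K) * s ^ k) *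
            Real.exp ((1 + 3 * K) * s ^ (k + 1) / (1 - s))) := by ring
        _ ≤ _ := by gcongr
    exact ⟨h.1.trans key, h.2.trans (by gcongr)⟩

/-- The recursion `y k = (1 + θ² + p k) y (k+1) + (-θ² + q k) y (k+2)` with exponentially small
`p`, `q` has a solution converging to `1`, uniformly and continuously in the closed unit disk. -/
theorem exists_backward_solution {p q : ℕ → ℂ → ℂ} {K s : ℝ} (hs0 : 0 < s) (hs1 : s < 1)
    (hK : 0 ≤ K) (hpc : ∀ k, Continuous (p k)) (hqc : ∀ k, Continuous (q k))
    (hp : ∀ k θ, ‖θ‖ ≤ 1 → ‖p k θ‖ ≤ K * (s ^ k * s ^ k))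
    (hq : ∀ k θ, ‖θ‖ ≤ 1 → ‖q k θ‖ ≤ K * (s ^ k * s ^ k)) :
    ∃ (y : ℕ → ℂ → ℂ) (K' : ℝ), 0 ≤ K' ∧
      (∀ k, ContinuousOn (y k) (Metric.closedBall 0 1)) ∧
      (∀ k θ, ‖θ‖ ≤ 1 → ‖y k θ - 1‖ ≤ K' * s ^ k) ∧
      ∀ k θ, ‖θ‖ ≤ 1 → y k θ = (1 + θ ^ 2 + p k θ) * y (k + 1) θ +
        (-θ ^ 2 + q k θ) * y (k + 2) θ := by
  have hs : 0 < 1 - s := by linarith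
  set G := Real.exp ((1 + 3 * K) / (1 - s))
  have hd : ∀ k θ, ‖θ‖ ≤ 1 → ∀ m, dist (backIter p q θ m k) (backIter p q θ (m + 1) k) ≤
      2 * K * s ^ k * G * s ^ m := by
    intro k θ hθ m
    obtain ⟨h1, h2⟩ := backIter_bound hs0 hs1 hK hθ (fun k => hp k θ hθ) (fun k => hq k θ hθ) m k
    have ht1 : s ^ k ≤ 1 := pow_le_one₀ hs0.le hs1.le
    have hG : Real.exp ((1 + 3 * K) * s ^ k / (1 - s)) ≤ G := by
      apply Real.exp_le_exp.2
      gcongr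
      exact mul_le_of_le_one_right (by positivity) ht1
    have h3 : 2 * K * s ^ (m + k) * Real.exp ((1 + 3 * K) * s ^ k / (1 - s)) ≤
        2 * K * s ^ k * G * s ^ m := by
      calc _ ≤ 2 * K * s ^ (m + k) * G := by gcongr
        _ = _ := by rw [pow_add]; ring
    rw [dist_comm, dist_eq_norm, Prod.norm_def]
    refine max_le (h1.trans h3) (h2.trans (le_trans ?_ h3))
    exact mul_le_of_le_one_left (by positivity) ht1
  have hlim : ∀ k θ, ∃ l, ‖θ‖ ≤ 1 → Tendsto (fun m => backIter p q θ m k) atTop (𝓝 l) := by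
    intro k θ
    by_cases hθ : ‖θ‖ ≤ 1
    · obtain ⟨l, hl⟩ := cauchySeq_tendsto_of_complete
        (cauchySeq_of_le_geometric s _ hs1 (hd k θ hθ))
      exact ⟨l, fun _ => hl⟩
    · exact ⟨0, fun h => absurd h hθ⟩
  choose z hz using hlim
  have hdist : ∀ k θ, ‖θ‖ ≤ 1 → ∀ m, dist (backIter p q θ m k) (z k θ) ≤
      2 * K * s ^ k * G * s ^ m / (1 - s) := fun k θ hθ m =>
    dist_le_of_le_geometric_of_tendsto s _ hs1 (hd k θ hθ) (hz k θ hθ) m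
  have hrec : ∀ k θ, ‖θ‖ ≤ 1 → z k θ = backStep (p k θ) (q k θ) θ (z (k + 1) θ) := by
    intro k θ hθ
    have h1 := (hz k θ hθ).comp (tendsto_add_atTop_nat 1)
    have hc : Continuous (backStep (p k θ) (q k θ) θ) := by
      unfold backStep
      fun_prop
    exact tendsto_nhds_unique h1 ((hc.tendsto _).comp (hz (k + 1) θ hθ))
  refine ⟨fun k θ => (z k θ).1, 2 * K * G / (1 - s), by positivity, ?_, ?_, ?_⟩
  · intro k
    -- The geometric bound does not depend on `θ`, so continuity of the polynomial-like approximants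
    -- passes to the limit.
    have hu : TendstoUniformlyOn (fun m θ => backIter p q θ m k) (z k) atTop
        (Metric.closedBall 0 1) := by
      rw [Metric.tendstoUniformlyOn_iff]
      intro δ hδ
      have ht : Tendsto (fun m : ℕ => 2 * K * s ^ k * G * s ^ m / (1 - s)) atTop (𝓝 0) := by
        have := ((tendsto_pow_atTop_nhds_zero_of_lt_one hs0.le hs1).const_mul
          (2 * K * s ^ k * G)).div_const (1 - s)
        simpa using this
      filter_upwards [ht.eventually (gt_mem_nhds hδ)] with m hm θ hθ
      rw [dist_comm]
      exact (hdist k θ (by simpa using hθ) m).trans_lt hm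
    have hc := hu.continuousOn
      (Eventually.of_forall fun m => (continuous_backIter hpc hqc m k).continuousOn).frequently
    exact continuous_fst.comp_continuousOn hc
  · intro k θ hθ
    have h := hdist k θ hθ 0
    rw [dist_comm, dist_eq_norm] at h
    have h' := (norm_fst_le (z k θ - backIter p q θ 0 k)).trans h
    simp only [backIter, Prod.fst_sub, pow_zero, mul_one] at h'
    calc _ ≤ _ := h'
      _ = _ := by ring
  · intro k θ hθ
    have h1 := hrec k θ hθ
    have h2 := hrec (k + 1) θ hθ
    have h3 : (z (k + 1) θ).1 = (z (k + 2) θ).1 + (z (k + 1) θ).2 := by rw [h2]; rfl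
    have h4 := congrArg Prod.fst h1
    simp only [backStep] at h4
    -- The second component of the limit is the difference of consecutive first components; this
    -- restores the second-order recursion.
    beta_reduce
    rw [h4]
    linear_combination (q k θ - θ ^ 2) * h3

/-- A recursion `r (k+1) = α k * r k + β k` with limiting coefficients, `|α| < 1`, converges. -/
theorem tendsto_of_affine_recursion {α β r : ℕ → ℂ} {α₀ β₀ : ℂ} (hα : Tendsto α atTop (𝓝 α₀))
    (hβ : Tendsto β atTop (𝓝 β₀)) (hα₀ : ‖α₀‖ < 1)
    (hr : ∀ᶠ k in atTop, r (k + 1) = α k * r k + β k) :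
    Tendsto r atTop (𝓝 (β₀ / (1 - α₀))) := by
  have hne : 1 - α₀ ≠ 0 := by
    intro h
    rw [← sub_eq_zero.1 h] at hα₀
    simp at hα₀
  set l := β₀ / (1 - α₀) with hl
  have hδ : Tendsto (fun k => (α k * l + β k) - l) atTop (𝓝 0) := by
    have := ((hα.mul_const l).add hβ).sub_const l
    convert this using 2
    rw [hl]
    field_simp
    ring
  obtain ⟨ρ, hρ1, hρ2⟩ := exists_between hα₀
  have hρ0 : 0 ≤ ρ := (norm_nonneg _).trans hρ1.le
  rw [Metric.tendsto_atTop]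
  intro ε hε
  have hη : 0 < ε / 2 * (1 - ρ) := mul_pos (by linarith) (by linarith)
  obtain ⟨N, hN⟩ := eventually_atTop.1 (((hα.norm.eventually (gt_mem_nhds hρ1)).and
    (hδ.norm.eventually (gt_mem_nhds (by simpa using hη)))).and hr)
  -- Past `N` the error obeys `x ↦ ρ x + ε / 2 * (1 - ρ)`, whose fixed point is `ε / 2`.
  have hb : ∀ m, ‖r (N + m) - l‖ ≤ ρ ^ m * ‖r N - l‖ + ε / 2 := by
    intro m
    induction m with
    | zero => simp; linarith
    | succ m ih =>
      obtain ⟨⟨h1, h2⟩, h3⟩ := hN (N + m) (by omega)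
      have e : r (N + (m + 1)) - l =
          α (N + m) * (r (N + m) - l) + (α (N + m) * l + β (N + m) - l) := by
        rw [← add_assoc, h3]; ring
      rw [e]
      calc _ ≤ ‖α (N + m)‖ * ‖r (N + m) - l‖ + ‖α (N + m) * l + β (N + m) - l‖ := by
            rw [← norm_mul]; exact norm_add_le _ _
        _ ≤ ρ * (ρ ^ m * ‖r N - l‖ + ε / 2) + ε / 2 * (1 - ρ) := by gcongr
        _ = _ := by ring
  have hp : Tendsto (fun m : ℕ => ρ ^ m * ‖r N - l‖) atTop (𝓝 0) := by
    simpa using (tendsto_pow_atTop_nhds_zero_of_lt_one hρ0 hρ2).mul_const ‖r N - l‖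
  obtain ⟨M, hM⟩ := eventually_atTop.1 (hp.eventually (gt_mem_nhds (half_pos hε)))
  refine ⟨N + M, fun n hn => ?_⟩
  obtain ⟨m, rfl⟩ := Nat.exists_eq_add_of_le hn
  rw [dist_eq_norm, add_assoc]
  linarith [hb (M + m), hM (M + m) (by omega)]

namespace WebSystem

variable {A C : Type*} (S : WebSystem A C)

/-! ### The three-term recurrence along a channel -/

theorem offDiag_pos (σ : C) (k : ℕ) : 0 < S.offDiag σ k := by
  have := S.off_diag_neg σ k
  unfold offDiag
  linarith

theorem offDiag_ne_zero (σ : C) (k : ℕ) : (S.offDiag σ k : ℂ) ≠ 0 :=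
  Complex.ofReal_ne_zero.2 (S.offDiag_pos σ k).ne'

theorem bLim_ne_zero (σ : C) : (S.bLim σ : ℂ) ≠ 0 :=
  Complex.ofReal_ne_zero.2 (S.bLim_pos σ).ne'

theorem exists_coeff_bound (σ : C) : ∃ s K : ℝ, 0 < s ∧ s < 1 ∧ 0 ≤ K ∧ ∀ k,
    |S.diag σ k - S.aLim σ| ≤ K * (s ^ k * s ^ k) ∧
    |S.offDiag σ k - S.bLim σ| ≤ K * (s ^ k * s ^ k) := by
  obtain ⟨ε, hε, h⟩ := S.decay
  obtain ⟨K, hK⟩ := (h σ).tendsto_atTop_zero.bddAbove_range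
  have hK' : ∀ k, (1 + ε) ^ k * (|S.diag σ k - S.aLim σ| + |S.offDiag σ k - S.bLim σ|) ≤ K :=
    fun k => hK ⟨k, rfl⟩
  have h1 : 1 < 1 + ε := by linarith
  -- The square root splits the decay `(1 + ε)⁻ᵏ` into the two factors `s ^ k` that `backStep_bound`
  -- spends separately.
  refine ⟨√(1 + ε)⁻¹, K, by positivity, ?_, (by positivity : (0 : ℝ) ≤ _).trans (hK' 0),
    fun k => ?_⟩
  · rw [Real.sqrt_lt' one_pos, one_pow]
    exact inv_lt_one_of_one_lt₀ h1
  · rw [← mul_pow, Real.mul_self_sqrt (by positivity), inv_pow, ← div_eq_mul_inv]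
    have := hK' k
    constructor <;> rw [le_div_iff₀ (by positivity), mul_comm]
    · refine le_trans ?_ this
      gcongr
      linarith [abs_nonneg (S.offDiag σ k - S.bLim σ)]
    · refine le_trans ?_ this
      gcongr
      linarith [abs_nonneg (S.diag σ k - S.aLim σ)]

theorem tendsto_offDiag (σ : C) : Tendsto (S.offDiag σ) atTop (𝓝 (S.bLim σ)) := by
  obtain ⟨s, K, hs0, hs1, hK, h⟩ := S.exists_coeff_bound σ
  rw [tendsto_iff_norm_sub_tendsto_zero]
  have hp := tendsto_pow_atTop_nhds_zero_of_lt_one hs0.le hs1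
  have := (hp.mul hp).const_mul K
  simp only [mul_zero] at this
  exact squeeze_zero (fun _ => norm_nonneg _) (fun k => (h k).2) this

theorem tendsto_offDiag_complex (σ : C) :
    Tendsto (fun k => (S.offDiag σ k : ℂ)) atTop (𝓝 (S.bLim σ)) :=
  (Complex.continuous_ofReal.tendsto _).comp (S.tendsto_offDiag σ)

/-- `x` satisfies the three-term recurrence with spectral parameter `lam` along the channel. -/
def IsChanSol (σ : C) (lam : ℂ) (x : ℕ → ℂ) : Prop :=
  ∀ k : ℕ, -(S.offDiag σ k : ℂ) * x k + S.diag σ (k + 1) * x (k + 1)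
      - S.offDiag σ (k + 1) * x (k + 2) = lam * x (k + 1)

/-- The Wronskian of two sequences along a channel. -/
noncomputable def wron (σ : C) (x y : ℕ → ℂ) (k : ℕ) : ℂ :=
  S.offDiag σ k * (x k * y (k + 1) - x (k + 1) * y k)

variable {S}

/-- Discrete Lagrange identity: eliminating the diagonal coefficient between the two recurrences
leaves only the difference of the spectral parameters. -/
theorem IsChanSol.wron_succ {σ : C} {lam mu : ℂ} {x y : ℕ → ℂ} (hx : S.IsChanSol σ lam x)
    (hy : S.IsChanSol σ mu y) (k : ℕ) :
    S.wron σ x y (k + 1) = S.wron σ x y k + (lam - mu) * (x (k + 1) * y (k + 1)) := by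
  have h1 := hx k
  have h2 := hy k
  unfold wron
  linear_combination y (k + 1) * h1 - x (k + 1) * h2

theorem IsChanSol.wron_eq {σ : C} {lam : ℂ} {x y : ℕ → ℂ} (hx : S.IsChanSol σ lam x)
    (hy : S.IsChanSol σ lam y) (k : ℕ) : S.wron σ x y k = S.wron σ x y 0 := by
  induction k with
  | zero => rfl
  | succ k ih => rw [hx.wron_succ hy, ih]; ring

theorem IsChanSol.wron_zero_eq_sum {σ : C} {lam mu : ℂ} {x y : ℕ → ℂ} (hx : S.IsChanSol σ lam x)
    (hy : S.IsChanSol σ mu y) (n : ℕ) : S.wron σ x y n =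
      S.wron σ x y 0 + (lam - mu) * ∑ k ∈ Finset.range n, x (k + 1) * y (k + 1) := by
  induction n with
  | zero => simp
  | succ n ih => rw [hx.wron_succ hy, ih, Finset.sum_range_succ]; ring

theorem IsChanSol.add {σ : C} {lam : ℂ} {x y : ℕ → ℂ} (hx : S.IsChanSol σ lam x)
    (hy : S.IsChanSol σ lam y) : S.IsChanSol σ lam (x + y) := by
  intro k
  simp only [Pi.add_apply]
  linear_combination hx k + hy k

theorem IsChanSol.const_mul {σ : C} {lam : ℂ} {x : ℕ → ℂ} (hx : S.IsChanSol σ lam x) (c : ℂ) :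
    S.IsChanSol σ lam (fun k => c * x k) := by
  intro k
  linear_combination c * hx k

theorem IsChanSol.sub {σ : C} {lam : ℂ} {x y : ℕ → ℂ} (hx : S.IsChanSol σ lam x)
    (hy : S.IsChanSol σ lam y) : S.IsChanSol σ lam (x - y) := by
  intro k
  simp only [Pi.sub_apply]
  linear_combination hx k - hy k

theorem IsChanSol.conj {σ : C} {lam : ℂ} {x : ℕ → ℂ} (hx : S.IsChanSol σ lam x) :
    S.IsChanSol σ ((starRingEnd ℂ) lam) (fun k => (starRingEnd ℂ) (x k)) := by
  intro k
  have := congrArg (starRingEnd ℂ) (hx k)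
  simpa using this

theorem IsChanSol.eq_zero {σ : C} {lam : ℂ} {x : ℕ → ℂ} (hx : S.IsChanSol σ lam x)
    (h0 : x 0 = 0) (h1 : x 1 = 0) : x = 0 := by
  have : ∀ k, x k = 0 ∧ x (k + 1) = 0 := by
    intro k
    induction k with
    | zero => exact ⟨h0, h1⟩
    | succ k ih =>
      refine ⟨ih.2, ?_⟩
      have := hx k
      rw [ih.1, ih.2] at this
      simpa [S.offDiag_ne_zero σ (k + 1)] using this
  funext k
  exact (this k).1

/-- A solution whose Wronskian with a non-zero solution vanishes is a multiple of it. -/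
theorem IsChanSol.eq_const_mul {σ : C} {lam : ℂ} {x y : ℕ → ℂ} (hx : S.IsChanSol σ lam x)
    (hy : S.IsChanSol σ lam y) (hy0 : y ≠ 0) (hw : S.wron σ x y 0 = 0) :
    ∃ c : ℂ, ∀ k, x k = c * y k := by
  have hw' : x 0 * y 1 - x 1 * y 0 = 0 := by
    simpa [wron, S.offDiag_ne_zero σ 0] using hw
  obtain ⟨c, h0, h1⟩ : ∃ c : ℂ, x 0 = c * y 0 ∧ x 1 = c * y 1 := by
    by_cases hz : y 0 = 0
    · have hz1 : y 1 ≠ 0 := fun h => hy0 (hy.eq_zero hz h)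
      refine ⟨x 1 / y 1, ?_, by field_simp⟩
      have : x 0 * y 1 = 0 := by simpa [hz] using hw'
      simp [hz, (mul_eq_zero.1 this).resolve_right hz1]
    · refine ⟨x 0 / y 0, by field_simp, ?_⟩
      field_simp
      linear_combination -hw'
  have := (hx.sub (hy.const_mul c)).eq_zero (by simp [h0]) (by simp [h1])
  exact ⟨c, fun k => sub_eq_zero.1 (congrFun this k)⟩

variable (S) in
/-- The solution of the recurrence with given initial values. -/
noncomputable def chanSol (σ : C) (lam u v : ℂ) : ℕ → ℂ × ℂ
  | 0 => (u, v)
  | k + 1 => ((chanSol σ lam u v k).2,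
      (-(S.offDiag σ k : ℂ) * (chanSol σ lam u v k).1 + S.diag σ (k + 1) * (chanSol σ lam u v k).2
        - lam * (chanSol σ lam u v k).2) / S.offDiag σ (k + 1))

variable (S) in
theorem exists_chanSol (σ : C) (lam u v : ℂ) :
    ∃ x, S.IsChanSol σ lam x ∧ x 0 = u ∧ x 1 = v := by
  refine ⟨fun k => (S.chanSol σ lam u v k).1, fun k => ?_, rfl, rfl⟩
  have h := S.offDiag_ne_zero σ (k + 1)
  simp only [chanSol]
  field_simp
  ring

/-! ### Jost solutions -/

variable (S) in
/-- The Jost solutions exist, and their amplitudes `θ⁻ᵏ e(k, θ)` are uniformly bounded and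
continuous up to the boundary of the disk. -/
theorem exists_amplitude (σ : C) : ∃ (y : ℕ → ℂ → ℂ) (K : ℝ), 0 ≤ K ∧
    (∀ k, ContinuousOn (y k) (Metric.closedBall 0 1)) ∧
    (∀ k θ, ‖θ‖ ≤ 1 → ‖y k θ‖ ≤ K) ∧
    (∀ θ, ‖θ‖ ≤ 1 → Tendsto (fun k => y k θ) atTop (𝓝 1)) ∧
    ∀ θ, θ ≠ 0 → ‖θ‖ ≤ 1 → S.IsChanSol σ (S.Wchan σ θ) (fun k => θ ^ k * y k θ) := by
  obtain ⟨s, K, hs0, hs1, hK, hab⟩ := S.exists_coeff_bound σ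
  obtain ⟨B, hB⟩ := ((S.tendsto_offDiag σ).inv₀ (S.bLim_pos σ).ne').bddAbove_range
  have hB' : ∀ k, (S.offDiag σ k)⁻¹ ≤ B := fun k => hB ⟨k, rfl⟩
  have hB0 : 0 ≤ B := (inv_pos.2 (S.offDiag_pos σ 0)).le.trans (hB' 0)
  have hBn : ∀ k, ‖((S.offDiag σ k : ℂ))⁻¹‖ ≤ B := by
    intro k
    rw [norm_inv, Complex.norm_real, Real.norm_of_nonneg (S.offDiag_pos σ k).le]
    exact hB' k
  have ha : ∀ k, ‖(S.diag σ k : ℂ) - S.aLim σ‖ ≤ K * (s ^ k * s ^ k) := by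
    intro k
    rw [← Complex.ofReal_sub, Complex.norm_real]
    exact (hab k).1
  have hb : ∀ k, ‖(S.offDiag σ k : ℂ) - S.bLim σ‖ ≤ K * (s ^ k * s ^ k) := by
    intro k
    rw [← Complex.ofReal_sub, Complex.norm_real]
    exact (hab k).2
  have hstep : ∀ k, K * (s ^ (k + 1) * s ^ (k + 1)) ≤ K * (s ^ k * s ^ k) := by
    intro k
    have : s ^ (k + 1) ≤ s ^ k := pow_le_pow_of_le_one hs0.le hs1.le (Nat.le_succ k)
    gcongr
  have hp : ∀ (k : ℕ) (θ : ℂ), ‖θ‖ ≤ 1 →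
      ‖((S.diag σ (k + 1) - S.aLim σ) * θ + (S.bLim σ - S.offDiag σ k) * (1 + θ ^ 2))
      * (S.offDiag σ k : ℂ)⁻¹‖ ≤
      3 * K * B * (s ^ k * s ^ k) := by
    intro k θ hθ
    have hθ2 : ‖θ ^ 2‖ ≤ 1 := by rw [norm_pow]; exact pow_le_one₀ (norm_nonneg _) hθ
    have h12 : ‖1 + θ ^ 2‖ ≤ 2 := (norm_add_le _ _).trans (by rw [norm_one]; linarith)
    have hb' := hb k
    rw [norm_sub_rev] at hb'
    have e1 : ‖((S.diag σ (k + 1) : ℂ) - S.aLim σ) * θ‖ ≤ K * (s ^ k * s ^ k) * 1 := by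
      rw [norm_mul]
      gcongr
      exact (ha (k + 1)).trans (hstep k)
    have e2 : ‖((S.bLim σ : ℂ) - S.offDiag σ k) * (1 + θ ^ 2)‖ ≤ K * (s ^ k * s ^ k) * 2 := by
      rw [norm_mul]
      gcongr
    rw [norm_mul]
    calc _ ≤ (K * (s ^ k * s ^ k) * 1 + K * (s ^ k * s ^ k) * 2) * B := by
          gcongr
          · exact norm_add_le_of_le e1 e2
          · exact hBn k
      _ = _ := by ring
  have hq : ∀ (k : ℕ) (θ : ℂ), ‖θ‖ ≤ 1 →
      ‖-θ ^ 2 * (S.offDiag σ (k + 1) - S.offDiag σ k) * (S.offDiag σ k : ℂ)⁻¹‖ ≤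
      3 * K * B * (s ^ k * s ^ k) := by
    intro k θ hθ
    have hθ2 : ‖-θ ^ 2‖ ≤ 1 := by
      rw [norm_neg, norm_pow]; exact pow_le_one₀ (norm_nonneg _) hθ
    have e1 : ‖(S.offDiag σ (k + 1) : ℂ) - S.offDiag σ k‖ ≤
        K * (s ^ k * s ^ k) + K * (s ^ k * s ^ k) := by
      have := norm_sub_le_of_le ((hb (k + 1)).trans (hstep k)) (hb k)
      simpa using this
    rw [norm_mul, norm_mul]
    calc _ ≤ 1 * (K * (s ^ k * s ^ k) + K * (s ^ k * s ^ k)) * B := by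
          gcongr
          exact hBn k
      _ ≤ _ := by
          have : 0 ≤ K * (s ^ k * s ^ k) * B := by positivity
          linarith
  -- Substituting `x k = θ ^ k * y k` and dividing by `θ ^ k * 𝔟(k)` gives a backward recursion for
  -- `y` with these `p` and `q`. It has no pole at `θ = 0`, so it can be treated on the whole closed
  -- disk.
  obtain ⟨y, K', hK', hyc, hyb, hyr⟩ := exists_backward_solution (K := 3 * K * B)
    (p := fun k θ => ((S.diag σ (k + 1) - S.aLim σ) * θ + (S.bLim σ - S.offDiag σ k) * (1 + θ ^ 2))
      * (S.offDiag σ k : ℂ)⁻¹)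
    (q := fun k θ => -θ ^ 2 * (S.offDiag σ (k + 1) - S.offDiag σ k) * (S.offDiag σ k : ℂ)⁻¹)
    hs0 hs1 (by positivity) (fun k => by fun_prop) (fun k => by fun_prop) hp hq
  refine ⟨y, 1 + K', by positivity, hyc, ?_, ?_, ?_⟩
  · intro k θ hθ
    have h1 := hyb k θ hθ
    have h2 : K' * s ^ k ≤ K' := mul_le_of_le_one_right hK' (pow_le_one₀ hs0.le hs1.le)
    calc ‖y k θ‖ = ‖1 + (y k θ - 1)‖ := by congr 1; ring
      _ ≤ ‖(1 : ℂ)‖ + ‖y k θ - 1‖ := norm_add_le _ _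
      _ ≤ 1 + K' := by rw [norm_one]; linarith
  · intro θ hθ
    rw [tendsto_iff_norm_sub_tendsto_zero]
    have := (tendsto_pow_atTop_nhds_zero_of_lt_one hs0.le hs1).const_mul K'
    rw [mul_zero] at this
    exact squeeze_zero (fun _ => norm_nonneg _) (fun k => hyb k θ hθ) this
  · intro θ h0 hθ k
    have h1 := hyr k θ hθ
    have h2 := S.offDiag_ne_zero σ k
    have h3 : (S.offDiag σ k : ℂ) * y k θ = (S.bLim σ * (1 + θ ^ 2) +
        (S.diag σ (k + 1) - S.aLim σ) * θ) * y (k + 1) θ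
        - S.offDiag σ (k + 1) * θ ^ 2 * y (k + 2) θ := by
      rw [h1]
      field_simp
      ring
    have h4 : S.Wchan σ θ * θ = S.aLim σ * θ - S.bLim σ * (1 + θ ^ 2) := by
      unfold Wchan
      field_simp
      ring
    simp only [pow_succ]
    linear_combination (-θ ^ k) * h3 - θ ^ k * y (k + 1) θ * h4

theorem IsJost.isChanSol {σ : C} {θ : ℂ} {x : ℕ → ℂ} (h : S.IsJost σ θ x) :
    S.IsChanSol σ (S.Wchan σ θ) x := h.1

theorem IsJost.ne_zero {σ : C} {θ : ℂ} {x : ℕ → ℂ} (h : S.IsJost σ θ x) : x ≠ 0 := by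
  rintro rfl
  have := h.2
  simp only [Pi.zero_apply, zero_div] at this
  exact zero_ne_one (tendsto_nhds_unique tendsto_const_nhds this)

/-- The Wronskian of two sequences with known asymptotics `l θ^k` and `m η^k`, `θ η = 1`. -/
theorem tendsto_wron {σ : C} {θ η l m : ℂ} {x y : ℕ → ℂ} (hθ : θ ≠ 0) (hθη : η * θ = 1)
    (hx : Tendsto (fun k => x k / θ ^ k) atTop (𝓝 l))
    (hy : Tendsto (fun k => y k / η ^ k) atTop (𝓝 m)) :
    Tendsto (S.wron σ x y) atTop (𝓝 (S.bLim σ * ((η - θ) * (l * m)))) := by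
  have hη : η ≠ 0 := left_ne_zero_of_mul_eq_one hθη
  have hx1 := hx.comp (tendsto_add_atTop_nat 1)
  have hy1 := hy.comp (tendsto_add_atTop_nat 1)
  have h := (S.tendsto_offDiag_complex σ).mul
    (((hx.mul hy1).mul_const η).sub ((hx1.mul hy).mul_const θ))
  rw [show l * m * η - l * m * θ = (η - θ) * (l * m) by ring] at h
  refine h.congr fun k => ?_
  have hp : η ^ k * θ ^ k = 1 := by rw [← mul_pow, hθη, one_pow]
  simp only [wron, Function.comp_apply, pow_succ]
  congr 2
  · field_simp
    linear_combination (-x k * y (k + 1)) * hp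
  · field_simp
    linear_combination (-x (k + 1) * y k) * hp

theorem tendsto_wron_zero {σ : C} {x y : ℕ → ℂ}
    (h1 : Tendsto (fun k => x k * y (k + 1)) atTop (𝓝 0))
    (h2 : Tendsto (fun k => x (k + 1) * y k) atTop (𝓝 0)) :
    Tendsto (S.wron σ x y) atTop (𝓝 0) := by
  have h := (S.tendsto_offDiag_complex σ).mul (h1.sub h2)
  simp only [sub_zero, mul_zero] at h
  exact h

/-- The difference of the two tends to zero and `y` is bounded, so their constant Wronskian is zero.
Hence the difference is `c * y`, and the asymptotics force `c = 0`. The argument covers `|θ| = 1`,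
including `θ = ±1`. -/
theorem IsJost.unique {σ : C} {θ : ℂ} {x y : ℕ → ℂ} (h0 : θ ≠ 0) (hθ : ‖θ‖ ≤ 1)
    (hx : S.IsJost σ θ x) (hy : S.IsJost σ θ y) : x = y := by
  have hd := hx.isChanSol.sub hy.isChanSol
  have hdl : Tendsto (fun k => (x - y) k / θ ^ k) atTop (𝓝 0) := by
    have := hx.2.sub hy.2
    simp only [sub_self] at this
    refine this.congr fun k => ?_
    simp only [Pi.sub_apply]
    ring
  have hsmall : ∀ j, Tendsto (fun k => (x - y) (k + j)) atTop (𝓝 0) := by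
    intro j
    have h1 : Tendsto (fun k => (x - y) k) atTop (𝓝 0) := by
      refine squeeze_zero_norm (a := fun k => ‖(x - y) k / θ ^ k‖) (fun k => ?_)
        (by simpa using hdl.norm)
      rw [norm_div, norm_pow]
      exact le_div_self (norm_nonneg _) (pow_pos (norm_pos_iff.2 h0) k)
        (pow_le_one₀ (norm_nonneg _) hθ)
    exact h1.comp (tendsto_add_atTop_nat j)
  have hyb : ∃ M, ∀ k, ‖y k‖ ≤ M := by
    obtain ⟨M, hM⟩ := hy.2.norm.bddAbove_range
    refine ⟨M, fun k => ?_⟩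
    have h1 : ‖y k / θ ^ k‖ ≤ M := hM ⟨k, rfl⟩
    refine le_trans ?_ h1
    rw [norm_div, norm_pow]
    exact le_div_self (norm_nonneg _) (pow_pos (norm_pos_iff.2 h0) k)
        (pow_le_one₀ (norm_nonneg _) hθ)
  obtain ⟨M, hM⟩ := hyb
  have hprod : ∀ i j, Tendsto (fun k => (x - y) (k + i) * y (k + j)) atTop (𝓝 0) := by
    intro i j
    refine squeeze_zero_norm (a := fun k => ‖(x - y) (k + i)‖ * M) (fun k => ?_) ?_
    · rw [norm_mul]
      gcongr
      exact hM _
    · simpa using (hsmall i).norm.mul_const M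
  have hw : Tendsto (S.wron σ (x - y) y) atTop (𝓝 0) :=
    tendsto_wron_zero (hprod 0 1) (hprod 1 0)
  have hw0 : S.wron σ (x - y) y 0 = 0 :=
    tendsto_nhds_unique (tendsto_const_nhds.congr fun k => (hd.wron_eq hy.isChanSol k).symm) hw
  obtain ⟨c, hc⟩ := hd.eq_const_mul hy.isChanSol hy.ne_zero hw0
  have hc0 : c = 0 := by
    have h1 := hy.2.const_mul c
    rw [mul_one] at h1
    refine tendsto_nhds_unique h1 (hdl.congr fun k => ?_)
    rw [hc k, mul_div_assoc]
  funext k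
  have := hc k
  rw [hc0, zero_mul] at this
  exact sub_eq_zero.1 this

theorem isJost_amplitude {σ : C} {y : ℕ → ℂ → ℂ} {θ : ℂ} (h0 : θ ≠ 0)
    (hl : Tendsto (fun k => y k θ) atTop (𝓝 1))
    (hs : S.IsChanSol σ (S.Wchan σ θ) (fun k => θ ^ k * y k θ)) :
    S.IsJost σ θ (fun k => θ ^ k * y k θ) := by
  refine ⟨hs, hl.congr fun k => ?_⟩
  rw [mul_div_cancel_left₀ _ (pow_ne_zero k h0)]

variable (S) in
theorem isJost_jost (σ : C) {θ : ℂ} (h0 : θ ≠ 0) (hθ : ‖θ‖ ≤ 1) :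
    S.IsJost σ θ (fun k => S.jost σ k θ) := by
  obtain ⟨y, K, -, -, -, hl, hs⟩ := S.exists_amplitude σ
  exact theOrZero_spec ⟨_, isJost_amplitude h0 (hl θ hθ) (hs θ h0 hθ)⟩

theorem IsJost.eq_jost {σ : C} {θ : ℂ} {x : ℕ → ℂ} (h0 : θ ≠ 0) (hθ : ‖θ‖ ≤ 1)
    (hx : S.IsJost σ θ x) (k : ℕ) : x k = S.jost σ k θ :=
  congrFun (hx.unique h0 hθ (S.isJost_jost σ h0 hθ)) k

-- Uniformity of `K` in `θ` supplies the majorant for the dominated convergence in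
-- `tendsto_jostPairing`.
variable (S) in
theorem exists_jost_bound (σ : C) : ∃ K : ℝ, 0 ≤ K ∧ ∀ k θ, θ ≠ 0 → ‖θ‖ ≤ 1 →
    ‖S.jost σ k θ‖ ≤ K * ‖θ‖ ^ k := by
  obtain ⟨y, K, hK, -, hb, hl, hs⟩ := S.exists_amplitude σ
  refine ⟨K, hK, fun k θ h0 hθ => ?_⟩
  rw [← (isJost_amplitude h0 (hl θ hθ) (hs θ h0 hθ)).eq_jost h0 hθ, norm_mul, norm_pow, mul_comm]
  gcongr
  exact hb k θ hθ

variable (S) in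
theorem continuousOn_jost (σ : C) (k : ℕ) :
    ContinuousOn (S.jost σ k) {θ | θ ≠ 0 ∧ ‖θ‖ ≤ 1} := by
  obtain ⟨y, K, hK, hc, hb, hl, hs⟩ := S.exists_amplitude σ
  have h : ContinuousOn (fun θ => θ ^ k * y k θ) {θ | θ ≠ 0 ∧ ‖θ‖ ≤ 1} :=
    (continuous_pow k).continuousOn.mul ((hc k).mono fun θ hθ => by simpa using hθ.2)
  refine h.congr fun θ hθ => ?_
  exact ((isJost_amplitude hθ.1 (hl θ hθ.2) (hs θ hθ.1 hθ.2)).eq_jost hθ.1 hθ.2 k).symm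

variable (S) in
theorem Wchan_conj (σ : C) (θ : ℂ) :
    S.Wchan σ ((starRingEnd ℂ) θ) = (starRingEnd ℂ) (S.Wchan σ θ) := by
  simp [Wchan]

variable (S) in
theorem jost_conj (σ : C) (k : ℕ) {θ : ℂ} (h0 : θ ≠ 0) (hθ : ‖θ‖ ≤ 1) :
    S.jost σ k ((starRingEnd ℂ) θ) = (starRingEnd ℂ) (S.jost σ k θ) := by
  have h : S.IsJost σ ((starRingEnd ℂ) θ) (fun k => (starRingEnd ℂ) (S.jost σ k θ)) := by
    have hj := S.isJost_jost σ h0 hθ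
    refine ⟨?_, ?_⟩
    · rw [Wchan_conj]
      exact hj.isChanSol.conj
    · have := (Complex.continuous_conj.tendsto _).comp hj.2
      simpa [Function.comp_def] using this
  exact (h.eq_jost (by simpa using h0) (by simpa using hθ) k).symm

/-- For `0 < |θ| < 1`, a solution `x` behaves like a multiple of `θ^(-k)`; the factor is determined
by the Wronskian of `x` and the Jost solution. -/
theorem IsChanSol.tendsto_mul_pow {σ : C} {θ : ℂ} {x : ℕ → ℂ} (h0 : θ ≠ 0) (hθ : ‖θ‖ < 1)
    (hx : S.IsChanSol σ (S.Wchan σ θ) x) :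
    Tendsto (fun k => x k / θ⁻¹ ^ k) atTop (𝓝 (S.wron σ x (fun k => S.jost σ k θ) 0 * θ /
      (S.bLim σ * (θ ^ 2 - 1)))) := by
  have hj := S.isJost_jost σ h0 hθ.le
  set e : ℕ → ℂ := fun k => S.jost σ k θ
  have hw := hx.wron_eq hj.isChanSol
  set w := S.wron σ x e 0
  have hε := hj.2
  have hε1 := hε.comp (tendsto_add_atTop_nat 1)
  -- Reduction of order: solving the constant Wronskian `w` for `x (k + 1)` gives an affine
  -- recursion for `x k * θ ^ k`. Its multiplier tends to `θ ^ 2`, of modulus below `1`.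
  have hα : Tendsto (fun k => θ ^ 2 * (e (k + 1) / θ ^ (k + 1) / (e k / θ ^ k))) atTop
      (𝓝 (θ ^ 2)) := by
    have := (hε1.div hε one_ne_zero).const_mul (θ ^ 2)
    simpa using this
  have hβ : Tendsto (fun k => -θ * w / (S.offDiag σ k * (e k / θ ^ k))) atTop
      (𝓝 (-θ * w / S.bLim σ)) := by
    have := tendsto_const_nhds (x := -θ * w).div ((S.tendsto_offDiag_complex σ).mul hε)
      (by simpa using S.bLim_ne_zero σ)
    rw [mul_one] at this
    exact this
  have hθ2 : ‖θ ^ 2‖ < 1 := by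
    rw [norm_pow]
    exact pow_lt_one₀ (norm_nonneg _) hθ two_ne_zero
  have hne : θ ^ 2 - 1 ≠ 0 := by
    intro h
    rw [sub_eq_zero.1 h] at hθ2
    simp at hθ2
  have hne' : 1 - θ ^ 2 ≠ 0 := by
    rw [← neg_sub]
    exact neg_ne_zero.2 hne
  have key := tendsto_of_affine_recursion hα hβ hθ2 (r := fun k => x k / θ⁻¹ ^ k) ?_
  · convert key using 2
    have := S.bLim_ne_zero σ
    field_simp
    ring
  · filter_upwards [hε.eventually_ne one_ne_zero] with k hk
    have hek : e k ≠ 0 := fun h => hk (by simp [h])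
    have hb := S.offDiag_ne_zero σ k
    have h2 : (S.offDiag σ k : ℂ) * (x k * e (k + 1) - x (k + 1) * e k) = w := hw k
    rw [← h2]
    simp only [inv_pow]
    field_simp
    ring

end WebSystem

/-! ### The Joukowski map -/

theorem joukowski_im (c β : ℝ) (z : ℂ) :
    ((c : ℂ) - β * (z + z⁻¹)).im = β * z.im * ((Complex.normSq z)⁻¹ - 1) := by
  simp [Complex.inv_im]
  ring

theorem joukowski_of_norm_eq_one (c β : ℝ) {z : ℂ} (hz : ‖z‖ = 1) :
    (c : ℂ) - β * (z + z⁻¹) = ((c - 2 * β * z.re : ℝ) : ℂ) := by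
  have h : z⁻¹ = (starRingEnd ℂ) z := by
    rw [Complex.inv_def, Complex.normSq_eq_norm_sq, hz]
    simp
  rw [h, Complex.add_conj]
  push_cast
  ring

theorem joukowski_injective_or {c β z w : ℂ} (hβ : β ≠ 0) (hz : z ≠ 0) (hw : w ≠ 0)
    (h : c - β * (z + z⁻¹) = c - β * (w + w⁻¹)) : z = w ∨ z * w = 1 := by
  have h1 : z + z⁻¹ = w + w⁻¹ := mul_left_cancel₀ hβ (sub_right_injective h)
  field_simp at h1
  have h2 : (z - w) * (z * w - 1) = 0 := by linear_combination h1
  rcases mul_eq_zero.1 h2 with h3 | h3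
  · exact Or.inl (sub_eq_zero.1 h3)
  · exact Or.inr (sub_eq_zero.1 h3)

/-- The equation is quadratic in `z` and its roots have product `1`, so one of them lies in the
closed disk. -/
theorem exists_joukowski (c l : ℂ) {β : ℂ} (hβ : β ≠ 0) :
    ∃ z : ℂ, z ≠ 0 ∧ ‖z‖ ≤ 1 ∧ c - β * (z + z⁻¹) = l := by
  obtain ⟨s, hs⟩ := IsAlgClosed.exists_pow_nat_eq (((c - l) / β) ^ 2 - 4) (n := 2) two_pos
  set z := ((c - l) / β + s) / 2 with hz
  have hz2 : z * ((c - l) / β - z) = 1 := by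
    rw [hz]
    linear_combination (-1 / 4 : ℂ) * hs
  have hz0 : z ≠ 0 := left_ne_zero_of_mul_eq_one hz2
  have hzi : z⁻¹ = (c - l) / β - z := inv_eq_of_mul_eq_one_right hz2
  have he : c - β * (z + z⁻¹) = l := by
    rw [hzi]
    field_simp
    ring
  rcases le_total ‖z‖ 1 with h | h
  · exact ⟨z, hz0, h, he⟩
  · refine ⟨z⁻¹, inv_ne_zero hz0, ?_, ?_⟩
    · rw [norm_inv]
      exact inv_le_one_of_one_le₀ h
    · rw [inv_inv, add_comm, he]

/-! ### The map `θ_γ` on the closed disk -/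

namespace WebSystem

variable {A C : Type*} (S : WebSystem A C)

theorem lower_le [Finite C] (γ : C) : S.lower ≤ S.aLim γ - 2 * S.bLim γ :=
  ciInf_le (Set.finite_range _).bddBelow γ

theorem le_upper [Finite C] (γ : C) : S.aLim γ + 2 * S.bLim γ ≤ S.upper :=
  le_ciSup (f := fun γ => S.aLim γ + 2 * S.bLim γ) (Set.finite_range _).bddAbove γ

theorem b_pos [Finite C] (γ : C) : 0 < S.b := by
  have h1 := S.lower_le γ
  have h2 := S.le_upper γ
  have h3 := S.bLim_pos γ
  unfold b
  linarith

theorem a_sub_two_b : S.a - 2 * S.b = S.lower := by unfold a b; ring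

theorem a_add_two_b : S.a + 2 * S.b = S.upper := by unfold a b; ring

theorem W_conj (ω : ℂ) : S.W ((starRingEnd ℂ) ω) = (starRingEnd ℂ) (S.W ω) := by
  simp [W]

theorem W_of_norm_eq_one {ω : ℂ} (hω : ‖ω‖ = 1) :
    S.W ω = ((S.a - 2 * S.b * ω.re : ℝ) : ℂ) := joukowski_of_norm_eq_one _ _ hω

theorem Wchan_of_norm_eq_one (γ : C) {θ : ℂ} (hθ : ‖θ‖ = 1) :
    S.Wchan γ θ = ((S.aLim γ - 2 * S.bLim γ * θ.re : ℝ) : ℂ) := joukowski_of_norm_eq_one _ _ hθ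

theorem W_im (ω : ℂ) : (S.W ω).im = S.b * ω.im * ((Complex.normSq ω)⁻¹ - 1) := joukowski_im _ _ _

theorem Wchan_im (γ : C) (θ : ℂ) :
    (S.Wchan γ θ).im = S.bLim γ * θ.im * ((Complex.normSq θ)⁻¹ - 1) := joukowski_im _ _ _

theorem normSq_inv_sub_one_nonneg {z : ℂ} (h0 : z ≠ 0) (hz : ‖z‖ ≤ 1) :
    0 ≤ (Complex.normSq z)⁻¹ - 1 := by
  have h1 : Complex.normSq z ≤ 1 := by
    rw [Complex.normSq_eq_norm_sq]
    exact pow_le_one₀ (norm_nonneg _) hz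
  have := one_le_inv_iff₀.2 ⟨Complex.normSq_pos.2 h0, h1⟩
  linarith

theorem normSq_inv_sub_one_pos {z : ℂ} (h0 : z ≠ 0) (hz : ‖z‖ < 1) :
    0 < (Complex.normSq z)⁻¹ - 1 := by
  have h1 : Complex.normSq z < 1 := by
    rw [Complex.normSq_eq_norm_sq]
    exact pow_lt_one₀ (norm_nonneg _) hz two_ne_zero
  have := one_lt_inv_iff₀.2 ⟨Complex.normSq_pos.2 h0, h1⟩
  linarith

theorem W_im_ne_zero [Finite C] (γ : C) {ω : ℂ} (h0 : ω ≠ 0) (hω : ‖ω‖ < 1) (him : ω.im ≠ 0) :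
    (S.W ω).im ≠ 0 := by
  rw [W_im]
  exact mul_ne_zero (mul_ne_zero (S.b_pos γ).ne' him) (normSq_inv_sub_one_pos h0 hω).ne'

/-- At real points the spectral parameter lies outside the bands. -/
theorem W_of_real [Finite C] (γ : C) {ω : ℂ} (h0 : ω ≠ 0) (hω : ‖ω‖ ≤ 1) (him : ω.im = 0) :
    (S.W ω).re ≤ S.lower ∨ S.upper ≤ (S.W ω).re := by
  obtain ⟨x, rfl⟩ : ∃ x : ℝ, ω = x := ⟨ω.re, Complex.ext rfl (by simpa using him)⟩
  have hx0 : x ≠ 0 := by simpa using h0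
  have hx1 : |x| ≤ 1 := by simpa using hω
  have hb := S.b_pos γ
  have hW : S.W (x : ℂ) = ((S.a - S.b * (x + x⁻¹) : ℝ) : ℂ) := by
    unfold W; push_cast; ring
  rw [hW, Complex.ofReal_re, ← a_sub_two_b, ← a_add_two_b]
  rcases lt_or_gt_of_ne hx0 with h | h
  · right
    have : x + x⁻¹ ≤ -2 := by
      have : x + x⁻¹ + 2 = (x + 1) ^ 2 * x⁻¹ := by field_simp; ring
      have h2 : (x + 1) ^ 2 * x⁻¹ ≤ 0 :=
        mul_nonpos_of_nonneg_of_nonpos (sq_nonneg _) (inv_nonpos.2 h.le)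
      linarith
    nlinarith
  · left
    have : 2 ≤ x + x⁻¹ := by
      have : x + x⁻¹ - 2 = (x - 1) ^ 2 * x⁻¹ := by field_simp; ring
      have h2 : 0 ≤ (x - 1) ^ 2 * x⁻¹ := mul_nonneg (sq_nonneg _) (inv_nonneg.2 h.le)
      linarith
    nlinarith

/-- The spectral parameter determines the point of the closed disk up to inversion. -/
theorem W_injective_or [Finite C] (γ : C) {z w : ℂ} (hz : z ≠ 0) (hw : w ≠ 0) (h : S.W z = S.W w) :
    z = w ∨ z * w = 1 :=
  joukowski_injective_or (Complex.ofReal_ne_zero.2 (S.b_pos γ).ne') hz hw h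

theorem W_ne_of_norm_lt [Finite C] (γ : C) {z w : ℂ} (hz : z ≠ 0) (hz1 : ‖z‖ < 1) (hw : ‖w‖ = 1) :
    S.W z ≠ S.W w := by
  intro h
  have hw0 : w ≠ 0 := by rintro rfl; simp at hw
  rcases S.W_injective_or γ hz hw0 h with rfl | h1
  · linarith
  · have := congrArg norm h1
    rw [norm_mul, hw, mul_one, norm_one] at this
    linarith

/-- The defining property of `θ_γ(ω)`. -/
def IsTheta (γ : C) (ω θ : ℂ) : Prop :=
  θ ≠ 0 ∧ ‖θ‖ ≤ 1 ∧ S.Wchan γ θ = S.W ω ∧ 0 ≤ θ.im * ω.im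

/-- For a root inside the disk the sign condition is automatic, since the Joukowski maps preserve
the sign of the imaginary part. On the circle the conjugate is a root too, and one of the two has
the right sign. -/
theorem exists_isTheta [Finite C] (γ : C) {ω : ℂ} (h0 : ω ≠ 0) (hω : ‖ω‖ ≤ 1) :
    ∃ θ, S.IsTheta γ ω θ := by
  obtain ⟨z, hz0, hz1, hz⟩ := exists_joukowski (S.aLim γ) (S.W ω) (S.bLim_ne_zero γ)
  have hz' : S.Wchan γ z = S.W ω := hz
  rcases hz1.lt_or_eq with h | h
  · refine ⟨z, hz0, hz1, hz', ?_⟩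
    have h1 := congrArg (fun l : ℂ => l.im * ω.im) hz'
    simp only [Wchan_im, W_im] at h1
    have h2 := mul_nonneg (mul_nonneg (S.b_pos γ).le (mul_self_nonneg ω.im))
      (normSq_inv_sub_one_nonneg h0 hω)
    have h3 := mul_pos (S.bLim_pos γ) (normSq_inv_sub_one_pos hz0 h)
    refine nonneg_of_mul_nonneg_right (a := S.bLim γ * ((Complex.normSq z)⁻¹ - 1)) ?_ h3
    linarith
  · rcases le_total 0 (z.im * ω.im) with h1 | h1
    · exact ⟨z, hz0, hz1, hz', h1⟩
    · refine ⟨(starRingEnd ℂ) z, by simpa using hz0, by simpa using hz1, ?_, by simpa using h1⟩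
      rw [Wchan_conj, ← hz', Wchan_of_norm_eq_one _ _ h, Complex.conj_ofReal]

/-- Distinct candidates would be reciprocal, hence conjugate points of the circle, and the sign
condition leaves only `θ₁` real or `ω` real. A real `ω` puts `W ω` outside the open bands, which
again forces `θ₁ = ±1`. -/
theorem IsTheta.unique [Finite C] {γ : C} {ω θ₁ θ₂ : ℂ} (h0 : ω ≠ 0) (hω : ‖ω‖ ≤ 1)
    (h₁ : S.IsTheta γ ω θ₁) (h₂ : S.IsTheta γ ω θ₂) : θ₁ = θ₂ := by
  obtain ⟨ha0, ha1, haW, hai⟩ := h₁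
  obtain ⟨hb0, hb1, hbW, hbi⟩ := h₂
  rcases joukowski_injective_or (S.bLim_ne_zero γ) ha0 hb0 (haW.trans hbW.symm) with h | h
  · exact h
  have hn := congrArg norm h
  rw [norm_mul, norm_one] at hn
  have hna : ‖θ₁‖ = 1 := by
    refine le_antisymm ha1 ?_
    rw [← hn]
    exact mul_le_of_le_one_right (norm_nonneg _) hb1
  have hconj : θ₂ = (starRingEnd ℂ) θ₁ := by
    have h1 : θ₁ * (starRingEnd ℂ) θ₁ = 1 := by
      rw [Complex.mul_conj, Complex.normSq_eq_norm_sq, hna]; simp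
    exact mul_left_cancel₀ ha0 (h.trans h1.symm)
  have hi : θ₂.im = -θ₁.im := by rw [hconj, Complex.conj_im]
  rw [hi] at hbi
  have hz : θ₁.im * ω.im = 0 := by linarith
  have him : θ₁.im = 0 := by
    rcases mul_eq_zero.1 hz with h1 | h1
    · exact h1
    have hre : (S.W ω).re = S.aLim γ - 2 * S.bLim γ * θ₁.re := by
      rw [← haW, Wchan_of_norm_eq_one _ _ hna, Complex.ofReal_re]
    have h3 := Complex.sq_norm θ₁
    rw [hna, Complex.normSq_apply] at h3
    have hb := S.bLim_pos γ
    have hl := S.lower_le γ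
    have hu := S.le_upper γ
    rcases S.W_of_real γ h0 hω h1 with h4 | h4
    · have : 1 ≤ θ₁.re := by
        by_contra! hc
        have := mul_lt_mul_of_pos_left hc hb
        linarith
      nlinarith
    · have : θ₁.re ≤ -1 := by
        by_contra! hc
        have := mul_lt_mul_of_pos_left hc hb
        linarith
      nlinarith
  rw [hconj]
  exact (Complex.conj_eq_iff_im.2 him).symm

theorem isTheta_theta [Finite C] (γ : C) {ω : ℂ} (h0 : ω ≠ 0) (hω : ‖ω‖ ≤ 1) :
    S.IsTheta γ ω (S.theta γ ω) :=
  theOrZero_spec (S.exists_isTheta γ h0 hω)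

theorem theta_ne_zero [Finite C] (γ : C) {ω : ℂ} (h0 : ω ≠ 0) (hω : ‖ω‖ ≤ 1) :
    S.theta γ ω ≠ 0 := (S.isTheta_theta γ h0 hω).1

theorem norm_theta_le [Finite C] (γ : C) {ω : ℂ} (h0 : ω ≠ 0) (hω : ‖ω‖ ≤ 1) :
    ‖S.theta γ ω‖ ≤ 1 := (S.isTheta_theta γ h0 hω).2.1

theorem Wchan_theta [Finite C] (γ : C) {ω : ℂ} (h0 : ω ≠ 0) (hω : ‖ω‖ ≤ 1) :
    S.Wchan γ (S.theta γ ω) = S.W ω := (S.isTheta_theta γ h0 hω).2.2.1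

theorem theta_conj [Finite C] (γ : C) {ω : ℂ} (h0 : ω ≠ 0) (hω : ‖ω‖ ≤ 1) :
    S.theta γ ((starRingEnd ℂ) ω) = (starRingEnd ℂ) (S.theta γ ω) := by
  have h0' : (starRingEnd ℂ) ω ≠ 0 := by simpa using h0
  have hω' : ‖(starRingEnd ℂ) ω‖ ≤ 1 := by simpa using hω
  obtain ⟨h1, h2, h3, h4⟩ := S.isTheta_theta γ h0 hω
  refine (S.isTheta_theta γ h0' hω').unique S h0' hω' ⟨by simpa using h1, by simpa using h2, ?_, ?_⟩
  · rw [Wchan_conj, W_conj, h3]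
  · simpa using h4

/-- If `|θ_γ(ω)| = 1`, then `W ω` lies in the band of `γ`, hence in `[a - 2b, a + 2b]`. All these
values are taken by `W` on the unit circle, and never inside the disk. -/
theorem norm_theta_lt_one [Finite C] (γ : C) {ω : ℂ} (h0 : ω ≠ 0) (hω : ‖ω‖ < 1) :
    ‖S.theta γ ω‖ < 1 := by
  obtain ⟨-, h2, h3, -⟩ := S.isTheta_theta γ h0 hω.le
  refine lt_of_le_of_ne h2 fun h => ?_
  have h5 : S.W ω = ((S.aLim γ - 2 * S.bLim γ * (S.theta γ ω).re : ℝ) : ℂ) := by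
    rw [← h3, Wchan_of_norm_eq_one _ _ h]
  have h1re := Complex.abs_re_le_norm (S.theta γ ω)
  rw [h, abs_le] at h1re
  have hb := S.bLim_pos γ
  have hl := S.lower_le γ
  have hu := S.le_upper γ
  have hbb := S.b_pos γ
  have hlu : S.upper = S.lower + 4 * S.b := by unfold b; ring
  have ha : S.a = S.lower + 2 * S.b := by unfold a b; ring
  -- a point of the unit circle with the same spectral parameter
  obtain ⟨ζ, hζ, hζW⟩ : ∃ ζ : ℂ, ‖ζ‖ = 1 ∧ S.W ζ = S.W ω := by
    set t := (S.a - (S.aLim γ - 2 * S.bLim γ * (S.theta γ ω).re)) / (2 * S.b) with ht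
    have ht1 : t ≤ 1 := by
      rw [ht, div_le_one (by positivity)]
      have := mul_le_mul_of_nonneg_left h1re.2 hb.le
      linarith
    have ht2 : -1 ≤ t := by
      rw [ht, le_div_iff₀ (by positivity)]
      have := mul_le_mul_of_nonneg_left h1re.1 hb.le
      linarith
    have hn : ‖(⟨t, √(1 - t ^ 2)⟩ : ℂ)‖ = 1 := by
      rw [← sq_eq_sq₀ (norm_nonneg _) zero_le_one, Complex.sq_norm, Complex.normSq_mk,
        Real.mul_self_sqrt (by nlinarith)]
      ring
    refine ⟨⟨t, √(1 - t ^ 2)⟩, hn, ?_⟩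
    rw [W_of_norm_eq_one _ hn, h5, ht]
    congr 1
    dsimp only
    field_simp
    ring
  exact S.W_ne_of_norm_lt γ h0 hω hζ hζW.symm

theorem continuousAt_W {ω : ℂ} (h0 : ω ≠ 0) : ContinuousAt S.W ω := by
  unfold W
  fun_prop (disch := assumption)

/-- Compactness: the conditions defining `θ_γ` are closed, so every cluster point satisfies them and
uniqueness identifies it. -/
theorem continuousOn_theta [Finite C] (γ : C) :
    ContinuousOn (S.theta γ) {ω | ω ≠ 0 ∧ ‖ω‖ ≤ 1} := by
  intro ω hω
  refine (isCompact_closedBall (0 : ℂ) 1).tendsto_nhds_of_unique_mapClusterPt ?_ ?_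
  · filter_upwards [self_mem_nhdsWithin] with w hw
    simpa using S.norm_theta_le γ hw.1 hw.2
  · intro θ _ hcl
    obtain ⟨U, hU, hUθ⟩ := mapClusterPt_iff_ultrafilter.1 hcl
    have hmem : ∀ᶠ w in (U : Filter ℂ), w ≠ 0 ∧ ‖w‖ ≤ 1 := hU self_mem_nhdsWithin
    have hid : Tendsto (fun w : ℂ => w) U (𝓝 ω) := hU.trans nhdsWithin_le_nhds
    have hW : Tendsto S.W U (𝓝 (S.W ω)) := (S.continuousAt_W hω.1).tendsto.comp hid
    -- Clearing the denominator lets the equation pass to the limit before `θ ≠ 0` is known; at `θ =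
    -- 0` it would read `-b_γ = 0`.
    have hpoly : (S.aLim γ : ℂ) * θ - S.bLim γ * (θ ^ 2 + 1) = S.W ω * θ := by
      have h1 : Tendsto (fun w => (S.aLim γ : ℂ) * S.theta γ w
          - S.bLim γ * ((S.theta γ w) ^ 2 + 1)) U
          (𝓝 ((S.aLim γ : ℂ) * θ - S.bLim γ * (θ ^ 2 + 1))) :=
        (hUθ.const_mul _).sub (((hUθ.pow 2).add_const 1).const_mul _)
      refine tendsto_nhds_unique h1 ((hW.mul hUθ).congr' ?_)
      filter_upwards [hmem] with w hw
      have h2 := S.theta_ne_zero γ hw.1 hw.2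
      rw [← S.Wchan_theta γ hw.1 hw.2]
      unfold Wchan
      field_simp
    have hθ0 : θ ≠ 0 := by
      rintro rfl
      simp [S.bLim_ne_zero γ] at hpoly
    have hT : S.IsTheta γ ω θ := by
      refine ⟨hθ0, ?_, ?_, ?_⟩
      · refine le_of_tendsto hUθ.norm ?_
        filter_upwards [hmem] with w hw using S.norm_theta_le γ hw.1 hw.2
      · refine mul_right_cancel₀ hθ0 (Eq.trans ?_ hpoly)
        unfold Wchan
        field_simp
      · have h1 := ((Complex.continuous_im.tendsto _).comp hUθ).mul
          ((Complex.continuous_im.tendsto _).comp hid)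
        refine ge_of_tendsto h1 ?_
        filter_upwards [hmem] with w hw using (S.isTheta_theta γ hw.1 hw.2).2.2.2
    exact hT.unique S hω.1 hω.2 (S.isTheta_theta γ hω.1 hω.2)

theorem continuousOn_jost_theta [Finite C] (γ : C) (k : ℕ) :
    ContinuousOn (fun ω => S.jost γ k (S.theta γ ω)) {ω | ω ≠ 0 ∧ ‖ω‖ ≤ 1} :=
  (S.continuousOn_jost γ k).comp (S.continuousOn_theta γ) fun _ hω =>
    ⟨S.theta_ne_zero γ hω.1 hω.2, S.norm_theta_le γ hω.1 hω.2⟩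

/-- Away from the band edges, points of the unit circle are not real. -/
theorem im_ne_zero_of_not_isBandEdge [Finite C] [Nonempty C] {ω : ℂ} (hω : ‖ω‖ = 1)
    (he : ¬ S.IsBandEdge ω) : ω.im ≠ 0 := by
  intro him
  have h3 := Complex.sq_norm ω
  rw [hω, Complex.normSq_apply, him] at h3
  have h4 : (ω.re - 1) * (ω.re + 1) = 0 := by linarith
  have hW := S.W_of_norm_eq_one hω
  rcases mul_eq_zero.1 h4 with h5 | h5
  · obtain ⟨γ, hγ⟩ := exists_eq_ciInf_of_finite (f := fun γ => S.aLim γ - 2 * S.bLim γ)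
    refine he ⟨γ, Or.inl ?_⟩
    rw [hW, show ω.re = 1 by linarith, mul_one, a_sub_two_b]
    unfold lower
    rw [← hγ]
    push_cast
    ring
  · obtain ⟨γ, hγ⟩ := exists_eq_ciSup_of_finite (f := fun γ => S.aLim γ + 2 * S.bLim γ)
    refine he ⟨γ, Or.inr ?_⟩
    rw [hW, show ω.re = -1 by linarith, show S.a - 2 * S.b * -1 = S.a + 2 * S.b by ring,
      a_add_two_b]
    unfold upper
    rw [← hγ]
    push_cast
    ring

theorem theta_sq_ne_one [Finite C] (γ : C) {ω : ℂ} (h0 : ω ≠ 0) (hω : ‖ω‖ ≤ 1)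
    (he : ¬ S.IsBandEdge ω) : S.theta γ ω ^ 2 - 1 ≠ 0 := by
  intro h
  have hW := S.Wchan_theta γ h0 hω
  have h1 : (S.theta γ ω - 1) * (S.theta γ ω + 1) = 0 := by linear_combination h
  rcases mul_eq_zero.1 h1 with h2 | h2
  · refine he ⟨γ, Or.inl ?_⟩
    rw [← hW, sub_eq_zero.1 h2, Wchan]
    norm_num
    ring
  · refine he ⟨γ, Or.inr ?_⟩
    rw [← hW, eq_neg_of_add_eq_zero_left h2, Wchan]
    norm_num
    ring

/-- All open channels have `Im θ_γ` of the sign of `Im ω`; this common strict sign prevents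
cancellation of their fluxes in Green's formula. -/
theorem theta_im_mul_im_pos [Finite C] [Nonempty C] (γ : C) {ω : ℂ} (hω : ‖ω‖ = 1)
    (he : ¬ S.IsBandEdge ω) (hθ : ‖S.theta γ ω‖ = 1) : 0 < (S.theta γ ω).im * ω.im := by
  have h0 : ω ≠ 0 := by rintro rfl; simp at hω
  refine lt_of_le_of_ne (S.isTheta_theta γ h0 hω.le).2.2.2 (Ne.symm (mul_ne_zero ?_
    (S.im_ne_zero_of_not_isBandEdge hω he)))
  intro him
  refine S.theta_sq_ne_one γ h0 hω.le he ?_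
  have h3 := Complex.sq_norm (S.theta γ ω)
  rw [hθ, Complex.normSq_apply, him] at h3
  have h4 : S.theta γ ω = ((S.theta γ ω).re : ℂ) := Complex.ext rfl (by simpa using him)
  rw [h4, ← Complex.ofReal_pow, ← Complex.ofReal_one, ← Complex.ofReal_sub, Complex.ofReal_eq_zero]
  linarith

end WebSystem

namespace WebSystem

variable {A C : Type*} (S : WebSystem A C)

/-! ### The central part -/

/-- The particles which are not of the form `σ(k)`, `k ≥ 1`. -/
noncomputable def center : Finset A := S.finite_center.toFinset

theorem mem_center {α : A} : α ∈ S.center ↔ ∀ σ k, α ≠ S.chan σ (k + 1) := by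
  simp [center]

theorem chan_inj {γ σ : C} {k l : ℕ} (h : S.chan γ k = S.chan σ l) : γ = σ ∧ k = l := by
  have := S.chan_injective (a₁ := (γ, k)) (a₂ := (σ, l)) h
  simpa using this

theorem chan_zero_mem_center (γ : C) : S.chan γ 0 ∈ S.center :=
  S.mem_center.2 fun σ k h => by simpa using (S.chan_inj h).2

theorem not_mem_center {α : A} (h : α ∉ S.center) : ∃ σ k, α = S.chan σ (k + 1) := by
  simpa [mem_center] using h

theorem chan_succ_not_mem_center (γ : C) (k : ℕ) : S.chan γ (k + 1) ∉ S.center :=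
  fun h => S.mem_center.1 h γ k rfl

theorem eq_chan_zero {α : A} (hα : α ∈ S.center) {γ : C} {k : ℕ} (h : α = S.chan γ k) :
    α = S.chan γ 0 := by
  cases k with
  | zero => exact h
  | succ k => exact absurd h (S.mem_center.1 hα γ k)

theorem chan_row (σ : C) (k : ℕ) (ξ : A → ℂ) :
    ∑ᶠ β, (S.L (S.chan σ (k + 1)) β : ℂ) * ξ β =
      -(S.offDiag σ k : ℂ) * ξ (S.chan σ k) + S.diag σ (k + 1) * ξ (S.chan σ (k + 1))
        - S.offDiag σ (k + 1) * ξ (S.chan σ (k + 2)) := by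
  classical
  have h01 : S.chan σ k ≠ S.chan σ (k + 1) := fun h => by have := (S.chan_inj h).2; omega
  have h02 : S.chan σ k ≠ S.chan σ (k + 2) := fun h => by have := (S.chan_inj h).2; omega
  have h12 : S.chan σ (k + 1) ≠ S.chan σ (k + 2) := fun h => by have := (S.chan_inj h).2; omega
  rw [finsum_eq_sum_of_support_subset (s := {S.chan σ k, S.chan σ (k + 1), S.chan σ (k + 2)})]
  · rw [Finset.sum_insert (by simp [h01, h02]), Finset.sum_insert (by simp [h12]),
      Finset.sum_singleton, S.symm (S.chan σ (k + 1)) (S.chan σ k)]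
    simp only [offDiag, diag]
    push_cast
    ring
  · intro β hβ
    have h : S.L (S.chan σ (k + 1)) β ≠ 0 := by
      intro h
      simp [h] at hβ
    simpa using S.chan_local σ k β h

/-! ### Functions with prescribed values on the channels -/

open Classical in
/-- The function with values `x` on the channels and `v` on the rest of the central part. -/
noncomputable def glue (x : C → ℕ → ℂ) (v : S.center → ℂ) (α : A) : ℂ :=
  if h : ∃ p : C × ℕ, S.chan p.1 p.2 = α then x h.choose.1 h.choose.2
  else if h : α ∈ S.center then v ⟨α, h⟩ else 0

theorem glue_chan (x : C → ℕ → ℂ) (v : S.center → ℂ) (γ : C) (k : ℕ) :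
    S.glue x v (S.chan γ k) = x γ k := by
  have h : ∃ p : C × ℕ, S.chan p.1 p.2 = S.chan γ k := ⟨(γ, k), rfl⟩
  obtain ⟨h1, h2⟩ := S.chan_inj h.choose_spec
  rw [glue, dif_pos h, h1, h2]

theorem glue_center (x : C → ℕ → ℂ) (v : S.center → ℂ) (α : S.center)
    (h : ∀ γ, α.1 ≠ S.chan γ 0) : S.glue x v α = v α := by
  have h' : ¬ ∃ p : C × ℕ, S.chan p.1 p.2 = α := by
    rintro ⟨p, hp⟩
    exact h p.1 (S.eq_chan_zero α.2 hp.symm)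
  rw [glue, dif_neg h', dif_pos α.2]

theorem ext_chan_center {u v : A → ℂ} (h1 : ∀ γ k, u (S.chan γ k) = v (S.chan γ k))
    (h2 : ∀ α : S.center, (∀ γ, α.1 ≠ S.chan γ 0) → u α = v α) : u = v := by
  funext α
  by_cases hα : α ∈ S.center
  · by_cases hc : ∃ γ, α = S.chan γ 0
    · obtain ⟨γ, rfl⟩ := hc
      exact h1 γ 0
    · push Not at hc
      exact h2 ⟨α, hα⟩ hc
  · obtain ⟨γ, k, rfl⟩ := S.not_mem_center hα
    exact h1 γ (k + 1)

/-- The attachment point of a channel as an element of the central part. -/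
noncomputable def port (γ : C) : S.center := ⟨S.chan γ 0, S.chan_zero_mem_center γ⟩

/-- The functions which are multiples of `e γ` along every channel `γ`, parametrized by the central
part: the coordinate at `γ(0)` is the coefficient of `e γ`. -/
noncomputable def extend (e : C → ℕ → ℂ) : (S.center → ℂ) →ₗ[ℂ] (A → ℂ) where
  toFun v := S.glue (fun γ k => v (S.port γ) * e γ k) v
  map_add' v w := by
    refine S.ext_chan_center (fun γ k => ?_) (fun α hα => ?_)
    · simp only [Pi.add_apply, glue_chan]; ring
    · simp only [Pi.add_apply, glue_center _ _ _ _ hα]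
  map_smul' c v := by
    refine S.ext_chan_center (fun γ k => ?_) (fun α hα => ?_)
    · simp only [Pi.smul_apply, smul_eq_mul, RingHom.id_apply, glue_chan]; ring
    · simp only [Pi.smul_apply, smul_eq_mul, RingHom.id_apply, glue_center _ _ _ _ hα]

theorem extend_chan (e : C → ℕ → ℂ) (v : S.center → ℂ) (γ : C) (k : ℕ) :
    S.extend e v (S.chan γ k) = v (S.port γ) * e γ k :=
  S.glue_chan (fun γ k => v (S.port γ) * e γ k) v γ k

theorem extend_center (e : C → ℕ → ℂ) (v : S.center → ℂ) (α : S.center)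
    (h : ∀ γ, α.1 ≠ S.chan γ 0) : S.extend e v α = v α :=
  S.glue_center (fun γ k => v (S.port γ) * e γ k) v α h

/-- The unknown at `γ(0)` is the coefficient of `e γ`, not the value there, so injectivity does not
need `e γ 0 ≠ 0`. -/
theorem eq_zero_of_extend_eq_zero {e : C → ℕ → ℂ} (he : ∀ γ, e γ ≠ 0) {v : S.center → ℂ}
    (h : S.extend e v = 0) : v = 0 := by
  funext α
  by_cases hc : ∃ γ, α.1 = S.chan γ 0
  · obtain ⟨γ, hγ⟩ := hc
    obtain rfl : α = S.port γ := Subtype.ext hγ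
    obtain ⟨k, hk⟩ := Function.ne_iff.1 (he γ)
    have := congrFun h (S.chan γ k)
    rw [extend_chan] at this
    exact (mul_eq_zero.1 this).resolve_right hk
  · push Not at hc
    rw [← S.extend_center e v α hc, h]
    rfl

/-! ### Green's formula -/

variable [Fintype C]

open Classical in
/-- The rows of the interaction matrix in the central part. -/
noncomputable def centerOp : (A → ℂ) →ₗ[ℂ] (A → ℂ) where
  toFun ξ α := ∑ β ∈ S.center, (S.L α β : ℂ) * ξ β +
    ∑ γ, if α = S.chan γ 0 then -(S.offDiag γ 0 : ℂ) * ξ (S.chan γ 1) else 0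
  map_add' ξ η := by
    funext α
    simp only [Pi.add_apply, mul_add, Finset.sum_add_distrib]
    have h : ∀ γ, (if α = S.chan γ 0 then -(S.offDiag γ 0 : ℂ) * ξ (S.chan γ 1) +
        -(S.offDiag γ 0 : ℂ) * η (S.chan γ 1) else 0) =
        (if α = S.chan γ 0 then -(S.offDiag γ 0 : ℂ) * ξ (S.chan γ 1) else 0) +
        (if α = S.chan γ 0 then -(S.offDiag γ 0 : ℂ) * η (S.chan γ 1) else 0) := by
      intro γ
      split_ifs <;> simp
    rw [Finset.sum_congr rfl fun γ _ => h γ, Finset.sum_add_distrib]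
    ring
  map_smul' c ξ := by
    funext α
    simp only [Pi.smul_apply, smul_eq_mul, RingHom.id_apply, mul_add, Finset.mul_sum, mul_ite,
      mul_zero]
    congr 1
    · exact Finset.sum_congr rfl fun _ _ => by ring
    · exact Finset.sum_congr rfl fun _ _ => by split_ifs <;> ring

open Classical in
theorem centerOp_apply (ξ : A → ℂ) (α : A) : S.centerOp ξ α =
    ∑ β ∈ S.center, (S.L α β : ℂ) * ξ β +
      ∑ γ, if α = S.chan γ 0 then -(S.offDiag γ 0 : ℂ) * ξ (S.chan γ 1) else 0 := rfl

/-- By symmetry of `L` and locality of the channels, the only coupling from the centre into channel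
`γ` joins `γ(0)` to `γ(1)`. -/
theorem center_row {α : A} (hα : α ∈ S.center) (ξ : A → ℂ) :
    ∑ᶠ β, (S.L α β : ℂ) * ξ β = S.centerOp ξ α := by
  classical
  have hdisj : Disjoint S.center (Finset.univ.image fun γ => S.chan γ 1) := by
    rw [Finset.disjoint_right]
    intro β hβ
    obtain ⟨γ, -, rfl⟩ := Finset.mem_image.1 hβ
    exact S.chan_succ_not_mem_center γ 0
  have hL : ∀ γ k, S.L α (S.chan γ (k + 1)) ≠ 0 → α = S.chan γ 0 ∧ k = 0 := by
    intro γ k h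
    rw [S.symm] at h
    have h0 : α = S.chan γ k := by
      rcases S.chan_local γ k α h with h1 | h1 | h1
      · exact h1
      · exact absurd h1 (S.mem_center.1 hα γ k)
      · exact absurd h1 (S.mem_center.1 hα γ (k + 1))
    have h1 := S.eq_chan_zero hα h0
    exact ⟨h1, (S.chan_inj (h0.symm.trans h1)).2⟩
  rw [finsum_eq_sum_of_support_subset (s := S.center ∪ Finset.univ.image fun γ => S.chan γ 1),
    Finset.sum_union hdisj, Finset.sum_image, centerOp_apply]
  · congr 1
    refine Finset.sum_congr rfl fun γ _ => ?_
    split_ifs with h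
    · rw [h]
      simp [offDiag]
    · have : S.L α (S.chan γ 1) = 0 := by
        by_contra h1
        exact h (hL γ 0 h1).1
      simp [this]
  · intro γ _ σ _ h
    exact (S.chan_inj h).1
  · intro β hβ
    have h : S.L α β ≠ 0 := by
      intro h
      simp [h] at hβ
    by_cases hc : β ∈ S.center
    · simp [hc]
    · obtain ⟨γ, k, rfl⟩ := S.not_mem_center hc
      obtain ⟨-, rfl⟩ := hL γ k h
      simp

theorem isSolution_iff {lam : ℂ} {ξ : A → ℂ} : S.IsSolution lam ξ ↔
    (∀ γ, S.IsChanSol γ lam fun k => ξ (S.chan γ k)) ∧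
      ∀ α ∈ S.center, S.centerOp ξ α = lam * ξ α := by
  constructor
  · intro h
    refine ⟨fun γ k => ?_, fun α hα => ?_⟩
    · rw [← h, chan_row]
    · rw [← h, center_row _ hα]
  · rintro ⟨h1, h2⟩ α
    by_cases hα : α ∈ S.center
    · rw [center_row _ hα, h2 α hα]
    · obtain ⟨γ, k, rfl⟩ := S.not_mem_center hα
      rw [chan_row]
      exact h1 γ k

/-- The symmetric block of the centre cancels; the couplings of `γ(0)` to `γ(1)` that remain are the
Wronskians at `0`. -/
theorem centerOp_green (u v : A → ℂ) :
    ∑ α ∈ S.center, (S.centerOp u α * v α - u α * S.centerOp v α) =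
      ∑ γ, S.wron γ (fun k => u (S.chan γ k)) (fun k => v (S.chan γ k)) 0 := by
  classical
  have h1 : ∑ α ∈ S.center, ∑ β ∈ S.center, (S.L α β : ℂ) * u β * v α =
      ∑ α ∈ S.center, ∑ β ∈ S.center, u α * ((S.L α β : ℂ) * v β) := by
    rw [Finset.sum_comm]
    refine Finset.sum_congr rfl fun α _ => Finset.sum_congr rfl fun β _ => ?_
    rw [S.symm]
    ring
  have h2 : ∀ α, S.centerOp u α * v α - u α * S.centerOp v α =
      (∑ β ∈ S.center, (S.L α β : ℂ) * u β * v α - ∑ β ∈ S.center, u α * ((S.L α β : ℂ) * v β)) +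
      ∑ γ, if α = S.chan γ 0 then -(S.offDiag γ 0 : ℂ) * u (S.chan γ 1) * v α
        + S.offDiag γ 0 * u α * v (S.chan γ 1) else 0 := by
    intro α
    rw [centerOp_apply, centerOp_apply, add_mul, mul_add, Finset.sum_mul, Finset.sum_mul,
      Finset.mul_sum, Finset.mul_sum, add_sub_add_comm, ← Finset.sum_sub_distrib (s := Finset.univ)]
    congr 1
    refine Finset.sum_congr rfl fun γ _ => ?_
    split_ifs <;> ring
  rw [Finset.sum_congr rfl fun α _ => h2 α, Finset.sum_add_distrib, Finset.sum_sub_distrib, h1,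
    sub_self, zero_add, Finset.sum_comm]
  refine Finset.sum_congr rfl fun γ _ => ?_
  rw [Finset.sum_ite_eq' S.center, if_pos (S.chan_zero_mem_center γ)]
  unfold wron
  ring

/-- Green's formula: the Wronskians of two solutions at the ends of the channels. -/
theorem green {lam mu : ℂ} {u v : A → ℂ} (hu : S.IsSolution lam u) (hv : S.IsSolution mu v) :
    (lam - mu) * ∑ α ∈ S.center, u α * v α =
      ∑ γ, S.wron γ (fun k => u (S.chan γ k)) (fun k => v (S.chan γ k)) 0 := by
  rw [← centerOp_green, Finset.mul_sum]
  refine Finset.sum_congr rfl fun α hα => ?_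
  rw [(S.isSolution_iff.1 hu).2 α hα, (S.isSolution_iff.1 hv).2 α hα]
  ring

/-- The bilinear pairing of two functions on the set of particles. -/
noncomputable def pairing (u v : A → ℂ) : ℂ :=
  ∑ α ∈ S.center, u α * v α + ∑ γ, ∑' k, u (S.chan γ (k + 1)) * v (S.chan γ (k + 1))

/-- Green's formula on the centre is continued along the channels by summing the increments of the
Wronskians, whose values at infinity vanish. Different spectral parameters therefore give
orthogonality. -/
theorem mul_pairing_eq_zero {lam mu : ℂ} {u v : A → ℂ} (hu : S.IsSolution lam u)
    (hv : S.IsSolution mu v)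
    (hs : ∀ γ, Summable fun k => u (S.chan γ (k + 1)) * v (S.chan γ (k + 1)))
    (hw : ∀ γ, Tendsto (S.wron γ (fun k => u (S.chan γ k)) (fun k => v (S.chan γ k))) atTop (𝓝 0)) :
    (lam - mu) * S.pairing u v = 0 := by
  rw [pairing, mul_add, S.green hu hv, Finset.mul_sum, ← Finset.sum_add_distrib]
  refine Finset.sum_eq_zero fun γ _ => ?_
  have h := ((hs γ).hasSum.tendsto_sum_nat.const_mul (lam - mu)).const_add
    (S.wron γ (fun k => u (S.chan γ k)) (fun k => v (S.chan γ k)) 0)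
  refine tendsto_nhds_unique h ((hw γ).congr fun n => ?_)
  exact ((S.isSolution_iff.1 hu).1 γ).wron_zero_eq_sum ((S.isSolution_iff.1 hv).1 γ) n

/-- This pairing is the squared `l²` norm. Summability is essential, since a divergent `tsum` has
the value `0`. -/
theorem eq_zero_of_pairing_conj {u : A → ℂ}
    (hs : ∀ γ, Summable fun k => Complex.normSq (u (S.chan γ (k + 1))))
    (h : S.pairing u (fun α => (starRingEnd ℂ) (u α)) = 0) : u = 0 := by
  have h1 : ∑ α ∈ S.center, Complex.normSq (u α) +
      ∑ γ, ∑' k, Complex.normSq (u (S.chan γ (k + 1))) = 0 := by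
    have : ((∑ α ∈ S.center, Complex.normSq (u α) +
        ∑ γ, ∑' k, Complex.normSq (u (S.chan γ (k + 1))) : ℝ) : ℂ) = 0 := by
      rw [← h, pairing]
      push_cast
      simp only [Complex.mul_conj]
    exact_mod_cast this
  have hn1 : ∀ α ∈ S.center, 0 ≤ Complex.normSq (u α) := fun _ _ => Complex.normSq_nonneg _
  have hn2 : ∀ γ ∈ (Finset.univ : Finset C), 0 ≤ ∑' k, Complex.normSq (u (S.chan γ (k + 1))) :=
    fun _ _ => tsum_nonneg fun _ => Complex.normSq_nonneg _
  rw [add_eq_zero_iff_of_nonneg (Finset.sum_nonneg hn1) (Finset.sum_nonneg hn2),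
    Finset.sum_eq_zero_iff_of_nonneg hn1, Finset.sum_eq_zero_iff_of_nonneg hn2] at h1
  funext α
  by_cases hα : α ∈ S.center
  · exact Complex.normSq_eq_zero.1 (h1.1 α hα)
  · obtain ⟨γ, k, rfl⟩ := S.not_mem_center hα
    have h2 := (hs γ).hasSum
    rw [h1.2 γ (Finset.mem_univ γ),
      hasSum_zero_iff_of_nonneg fun _ => Complex.normSq_nonneg _] at h2
    exact Complex.normSq_eq_zero.1 (congrFun h2 k)

/-- The equation `L ξ = lam ξ` on the central part for functions in the range of `extend`. -/
noncomputable def centerMap (e : C → ℕ → ℂ) (lam : ℂ) :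
    (S.center → ℂ) →ₗ[ℂ] (S.center → ℂ) :=
  LinearMap.funLeft ℂ ℂ (Subtype.val : S.center → A) ∘ₗ
    (S.centerOp ∘ₗ S.extend e - lam • S.extend e)

theorem centerMap_apply (e : C → ℕ → ℂ) (lam : ℂ) (v : S.center → ℂ) (α : S.center) :
    S.centerMap e lam v α = S.centerOp (S.extend e v) α - lam * S.extend e v α := rfl

theorem isSolution_extend {e : C → ℕ → ℂ} {lam : ℂ} (he : ∀ γ, S.IsChanSol γ lam (e γ))
    {v : S.center → ℂ} (hv : S.centerMap e lam v = 0) : S.IsSolution lam (S.extend e v) := by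
  refine S.isSolution_iff.2 ⟨fun γ => ?_, fun α hα => ?_⟩
  · simp only [extend_chan]
    exact (he γ).const_mul _
  · exact sub_eq_zero.1 (congrFun hv ⟨α, hα⟩)

end WebSystem

/-! ### Conjugation of solutions, and Jost solutions at a common spectral parameter -/

namespace WebSystem

variable {A C : Type*} {S : WebSystem A C}

theorem IsSolution.conj {lam : ℂ} {ξ : A → ℂ} (h : S.IsSolution lam ξ) :
    S.IsSolution ((starRingEnd ℂ) lam) (fun α => (starRingEnd ℂ) (ξ α)) := by
  intro α
  have hf : (Function.support fun β => (S.L α β : ℂ) * ξ β).Finite := by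
    refine (S.finite_row α).subset fun β hβ hz => hβ ?_
    simp [hz]
  have h1 := (starRingEnd ℂ).toAddMonoidHom.map_finsum hf
  have h2 := congrArg (starRingEnd ℂ) (h α)
  rw [map_mul] at h2
  rw [← h2]
  refine Eq.trans ?_ h1.symm
  refine finsum_congr fun β => ?_
  simp

theorem IsSolution.chan [Fintype C] {lam : ℂ} {ξ : A → ℂ} (h : S.IsSolution lam ξ) (γ : C) :
    S.IsChanSol γ lam fun k => ξ (S.chan γ k) := (S.isSolution_iff.1 h).1 γ

theorem IsSolution.sub [Fintype C] {lam : ℂ} {ξ η : A → ℂ} (hξ : S.IsSolution lam ξ)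
    (hη : S.IsSolution lam η) : S.IsSolution lam (ξ - η) := by
  refine S.isSolution_iff.2 ⟨fun γ => (hξ.chan γ).sub (hη.chan γ), fun α hα => ?_⟩
  rw [map_sub, Pi.sub_apply, Pi.sub_apply, (S.isSolution_iff.1 hξ).2 α hα,
    (S.isSolution_iff.1 hη).2 α hα, mul_sub]

variable (S)

/-- The Jost solutions of all channels at the point `ω`. -/
noncomputable def jostAt (ω : ℂ) (γ : C) (k : ℕ) : ℂ := S.jost γ k (S.theta γ ω)

theorem isJost_jostAt [Finite C] {ω : ℂ} (h0 : ω ≠ 0) (hω : ‖ω‖ ≤ 1) (γ : C) :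
    S.IsJost γ (S.theta γ ω) (S.jostAt ω γ) :=
  S.isJost_jost γ (S.theta_ne_zero γ h0 hω) (S.norm_theta_le γ h0 hω)

theorem isChanSol_jostAt [Finite C] {ω : ℂ} (h0 : ω ≠ 0) (hω : ‖ω‖ ≤ 1) (γ : C) :
    S.IsChanSol γ (S.W ω) (S.jostAt ω γ) := by
  rw [← S.Wchan_theta γ h0 hω]
  exact (S.isJost_jostAt h0 hω γ).isChanSol

theorem jostAt_ne_zero [Finite C] {ω : ℂ} (h0 : ω ≠ 0) (hω : ‖ω‖ ≤ 1) (γ : C) :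
    S.jostAt ω γ ≠ 0 := (S.isJost_jostAt h0 hω γ).ne_zero

theorem jostAt_conj [Finite C] {ω : ℂ} (h0 : ω ≠ 0) (hω : ‖ω‖ ≤ 1) (γ : C) (k : ℕ) :
    S.jostAt ((starRingEnd ℂ) ω) γ k = (starRingEnd ℂ) (S.jostAt ω γ k) := by
  unfold jostAt
  rw [S.theta_conj γ h0 hω, S.jost_conj γ k (S.theta_ne_zero γ h0 hω) (S.norm_theta_le γ h0 hω)]

/-- Provides initial data transversal to the Jost solution `e`: this choice has Wronskian `𝔟(0)
(|e(0)|² + |e(1)|²)`, and two consecutive zeros would make `e` vanish. -/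
theorem jostAt_wron_ne_zero [Finite C] {ω : ℂ} (h0 : ω ≠ 0) (hω : ‖ω‖ ≤ 1) (γ : C) :
    S.wron γ (fun k => if k = 0 then (starRingEnd ℂ) (S.jostAt ω γ 1) else
      -(starRingEnd ℂ) (S.jostAt ω γ 0)) (S.jostAt ω γ) 0 ≠ 0 := by
  have h : S.wron γ (fun k => if k = 0 then (starRingEnd ℂ) (S.jostAt ω γ 1) else
      -(starRingEnd ℂ) (S.jostAt ω γ 0)) (S.jostAt ω γ) 0 = S.offDiag γ 0 *
      ((Complex.normSq (S.jostAt ω γ 1) + Complex.normSq (S.jostAt ω γ 0) : ℝ) : ℂ) := by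
    simp only [wron]
    push_cast
    rw [← Complex.mul_conj, ← Complex.mul_conj]
    ring
  rw [h]
  refine mul_ne_zero (S.offDiag_ne_zero γ 0) (Complex.ofReal_ne_zero.2 fun hz => ?_)
  rw [add_eq_zero_iff_of_nonneg (Complex.normSq_nonneg _) (Complex.normSq_nonneg _),
    Complex.normSq_eq_zero, Complex.normSq_eq_zero] at hz
  exact S.jostAt_ne_zero h0 hω γ ((S.isChanSol_jostAt h0 hω γ).eq_zero hz.2 hz.1)

/-- Growing solutions with prescribed direction of the initial values. -/
theorem exists_growing [Finite C] {ω : ℂ} (h0 : ω ≠ 0) (hω : ‖ω‖ ≤ 1) (γ : C)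
    (hθ : ‖S.theta γ ω‖ < 1) {d : ℕ → ℂ}
    (hd : S.wron γ d (S.jostAt ω γ) 0 ≠ 0) :
    ∃ x, S.IsChanSol γ (S.W ω) x ∧
      Tendsto (fun k => x k / (S.theta γ ω)⁻¹ ^ k) atTop (𝓝 1) ∧
      ∀ k ≤ 1, x k = S.bLim γ * (S.theta γ ω ^ 2 - 1) /
        (S.wron γ d (S.jostAt ω γ) 0 * S.theta γ ω) * d k := by
  have hθ0 := S.theta_ne_zero γ h0 hω
  obtain ⟨y, hy, hy0, hy1⟩ := S.exists_chanSol γ (S.W ω) (d 0) (d 1)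
  have hw : S.wron γ y (S.jostAt ω γ) 0 = S.wron γ d (S.jostAt ω γ) 0 := by
    simp only [wron, hy0, hy1, zero_add]
  have hlim := IsChanSol.tendsto_mul_pow (σ := γ) hθ0 hθ (x := y)
    (by rw [S.Wchan_theta γ h0 hω]; exact hy)
  have hlim' := hlim.const_mul (S.bLim γ * (S.theta γ ω ^ 2 - 1) /
        (S.wron γ d (S.jostAt ω γ) 0 * S.theta γ ω))
  have hne : S.theta γ ω ^ 2 - 1 ≠ 0 := by
    intro h
    have h1 := pow_lt_one₀ (norm_nonneg _) hθ two_ne_zero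
    rw [← norm_pow, sub_eq_zero.1 h, norm_one] at h1
    exact lt_irrefl _ h1
  have hb := S.bLim_ne_zero γ
  -- The factor is the reciprocal of the limit in `IsChanSol.tendsto_mul_pow`. Recording the values
  -- for `k ≤ 1` suffices later, because the central equations see no others.
  refine ⟨_, hy.const_mul (S.bLim γ * (S.theta γ ω ^ 2 - 1) /
        (S.wron γ d (S.jostAt ω γ) 0 * S.theta γ ω)), ?_, ?_⟩
  · have he : S.wron γ y (fun k => S.jost γ k (S.theta γ ω)) 0 =
        S.wron γ d (S.jostAt ω γ) 0 := hw
    rw [he] at hlim'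
    have e1 : S.bLim γ * (S.theta γ ω ^ 2 - 1) / (S.wron γ d (S.jostAt ω γ) 0 * S.theta γ ω) *
        (S.wron γ d (S.jostAt ω γ) 0 * S.theta γ ω / (S.bLim γ * (S.theta γ ω ^ 2 - 1))) = 1 := by
      field_simp
    rw [e1] at hlim'
    exact hlim'.congr fun k => (mul_div_assoc _ _ _).symm
  · intro k hk
    interval_cases k
    · rw [hy0]
    · rw [hy1]

theorem exists_jostAt_bound [Finite C] (γ : C) : ∃ K : ℝ, 0 ≤ K ∧ ∀ ω k, ω ≠ 0 → ‖ω‖ ≤ 1 →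
    ‖S.jostAt ω γ k‖ ≤ K * ‖S.theta γ ω‖ ^ k := by
  obtain ⟨K, hK, h⟩ := S.exists_jost_bound γ
  exact ⟨K, hK, fun ω k h0 hω => h k _ (S.theta_ne_zero γ h0 hω) (S.norm_theta_le γ h0 hω)⟩

theorem tendsto_jostAt_zero [Finite C] (γ : C) {ω : ℂ} (h0 : ω ≠ 0) (hω : ‖ω‖ ≤ 1)
    (hθ : ‖S.theta γ ω‖ < 1) : Tendsto (S.jostAt ω γ) atTop (𝓝 0) := by
  obtain ⟨K, hK, h⟩ := S.exists_jostAt_bound γ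
  refine squeeze_zero_norm (fun k => h ω k h0 hω) ?_
  simpa using (tendsto_pow_atTop_nhds_zero_of_lt_one (norm_nonneg _) hθ).const_mul K

/-- `ξ` is a multiple of the Jost solution along every channel. -/
def IsOutgoing (ω : ℂ) (ξ : A → ℂ) : Prop :=
  ∀ γ, ∃ c : ℂ, ∀ k, ξ (S.chan γ k) = c * S.jostAt ω γ k

theorem isOutgoing_extend (ω : ℂ) (v : S.center → ℂ) :
    S.IsOutgoing ω (S.extend (S.jostAt ω) v) :=
  fun γ => ⟨v (S.port γ), fun k => S.extend_chan _ v γ k⟩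

/-! ### Regular points -/

theorem centerMap_injective [Fintype C] {ω : ℂ} (h0 : ω ≠ 0) (hω : ‖ω‖ ≤ 1)
    (h : S.IsRegular ω) : Function.Injective (S.centerMap (S.jostAt ω) (S.W ω)) := by
  rw [← LinearMap.ker_eq_bot, LinearMap.ker_eq_bot']
  intro v hv
  exact S.eq_zero_of_extend_eq_zero (fun γ => S.jostAt_ne_zero h0 hω γ)
    (h _ (S.isSolution_extend (fun γ => S.isChanSol_jostAt h0 hω γ) hv) (S.isOutgoing_extend ω v))

theorem summable_norm_jostAt [Finite C] (γ : C) {ω : ℂ} (h0 : ω ≠ 0) (hω : ‖ω‖ ≤ 1)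
    (hθ : ‖S.theta γ ω‖ < 1) : Summable fun k => ‖S.jostAt ω γ (k + 1)‖ := by
  obtain ⟨K, hK, h⟩ := S.exists_jostAt_bound γ
  have h1 : Summable fun k => K * ‖S.theta γ ω‖ ^ k :=
    (summable_geometric_of_lt_one (norm_nonneg _) hθ).mul_left K
  exact (summable_nat_add_iff 1).2 (h1.of_nonneg_of_le (fun _ => norm_nonneg _)
    fun k => h ω k h0 hω)

/-- Non-real points of the open disk are regular. -/
theorem isRegular_of_im_ne_zero [Finite C] [Nonempty C] {ω : ℂ} (h0 : ω ≠ 0) (hω : ‖ω‖ < 1)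
    (him : ω.im ≠ 0) : S.IsRegular ω := by
  have := Fintype.ofFinite C
  intro ξ hξ hout
  choose c hc using hout
  have hz : ∀ γ, Tendsto (fun k => ξ (S.chan γ k)) atTop (𝓝 0) := by
    intro γ
    have := (S.tendsto_jostAt_zero γ h0 hω.le (S.norm_theta_lt_one γ h0 hω)).const_mul (c γ)
    rw [mul_zero] at this
    exact this.congr fun k => (hc γ k).symm
  have hs : ∀ γ, Summable fun k => Complex.normSq (ξ (S.chan γ (k + 1))) := by
    intro γ
    have h1 := (S.summable_norm_jostAt γ h0 hω.le (S.norm_theta_lt_one γ h0 hω)).mul_left ‖c γ‖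
    have h2 : Summable fun k => ‖ξ (S.chan γ (k + 1))‖ := by
      refine h1.congr fun k => ?_
      rw [hc γ, norm_mul]
      rfl
    have h3 : ∀ᶠ k in atTop, ‖ξ (S.chan γ (k + 1))‖ ≤ 1 := by
      have := ((hz γ).comp (tendsto_add_atTop_nat 1)).norm
      rw [norm_zero] at this
      exact (this.eventually (gt_mem_nhds one_pos)).mono fun _ h => le_of_lt h
    refine h2.of_norm_bounded_eventually_nat ?_
    filter_upwards [h3] with k hk
    rw [Real.norm_of_nonneg (Complex.normSq_nonneg _), Complex.normSq_eq_norm_sq, sq]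
    exact mul_le_of_le_one_left (norm_nonneg _) hk
  have hzc : ∀ γ, Tendsto (fun k => (starRingEnd ℂ) (ξ (S.chan γ k))) atTop (𝓝 0) := by
    intro γ
    have := (Complex.continuous_conj.tendsto _).comp (hz γ)
    rwa [map_zero] at this
  -- The decaying solution is paired with its conjugate, a solution at `conj (W ω) ≠ W ω`, so its
  -- norm is zero.
  have h1 := S.mul_pairing_eq_zero hξ hξ.conj ?_ ?_
  · refine S.eq_zero_of_pairing_conj hs ((mul_eq_zero.1 h1).resolve_left fun h => ?_)
    rw [sub_eq_zero, eq_comm, Complex.conj_eq_iff_im] at h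
    exact S.W_im_ne_zero (Classical.arbitrary C) h0 hω him h
  · intro γ
    simp only [Complex.mul_conj]
    exact Complex.ofRealCLM.summable (hs γ)
  · intro γ
    refine tendsto_wron_zero ?_ ?_
    · simpa using (hz γ).mul ((hzc γ).comp (tendsto_add_atTop_nat 1))
    · simpa using ((hz γ).comp (tendsto_add_atTop_nat 1)).mul (hzc γ)

/-- Regular points of the open disk accumulate at every point of the unit circle. -/
theorem neBot_regular [Finite C] [Nonempty C] {ω : ℂ} (hω : ‖ω‖ = 1) :
    (𝓝[{w | 0 < ‖w‖ ∧ ‖w‖ < 1 ∧ S.IsRegular w}] ω).NeBot := by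
  rw [← mem_closure_iff_nhdsWithin_neBot]
  -- The point `ω` is approached along the segment from a non-real `z` in the same closed
  -- half-plane. The segment stays off the real axis before reaching `ω`, even when `ω = ±1`.
  obtain ⟨z, hz1, hz2, hz3⟩ : ∃ z : ℂ, ‖z‖ < 1 ∧ z.im ≠ 0 ∧ 0 ≤ ω.im * z.im := by
    rcases le_total 0 ω.im with h | h
    · refine ⟨Complex.I / 2, by norm_num, by norm_num, ?_⟩
      simpa using h
    · refine ⟨-(Complex.I / 2), by norm_num, by norm_num, ?_⟩
      simp
      linarith
  have hlim : Tendsto (fun t : ℝ => (1 - (t : ℂ)) * ω + t * z) (𝓝[>] 0) (𝓝 ω) := by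
    have hc : Continuous fun t : ℝ => (1 - (t : ℂ)) * ω + t * z := by fun_prop
    have := (hc.tendsto 0).mono_left (nhdsWithin_le_nhds (s := Set.Ioi 0))
    simpa using this
  refine mem_closure_of_tendsto hlim ?_
  filter_upwards [Ioo_mem_nhdsGT (one_pos (α := ℝ))] with t ht
  have him : ((1 - (t : ℂ)) * ω + t * z).im ≠ 0 := by
    have e : ((1 - (t : ℂ)) * ω + t * z).im = (1 - t) * ω.im + t * z.im := by simp
    rw [e]
    intro h
    have h1 : (1 - t) * (ω.im * z.im) + t * (z.im * z.im) = 0 := by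
      linear_combination z.im * h
    have h2 : 0 ≤ (1 - t) * (ω.im * z.im) := mul_nonneg (by linarith [ht.2]) hz3
    have h3 : 0 < t * (z.im * z.im) := mul_pos ht.1 (mul_self_pos.2 hz2)
    linarith
  have hne : (1 - (t : ℂ)) * ω + t * z ≠ 0 := by
    intro h
    rw [h] at him
    simp at him
  have hlt : ‖(1 - (t : ℂ)) * ω + t * z‖ < 1 := by
    have e1 : ‖1 - (t : ℂ)‖ = 1 - t := by
      rw [← Complex.ofReal_one, ← Complex.ofReal_sub, Complex.norm_real,
        Real.norm_of_nonneg (by linarith [ht.2])]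
    have e2 : ‖(t : ℂ)‖ = t := by rw [Complex.norm_real, Real.norm_of_nonneg ht.1.le]
    calc _ ≤ ‖(1 - (t : ℂ)) * ω‖ + ‖t * z‖ := norm_add_le _ _
      _ = (1 - t) + t * ‖z‖ := by rw [norm_mul, norm_mul, e1, e2, hω, mul_one]
      _ < (1 - t) + t * 1 := by gcongr; exact ht.1
      _ = 1 := by ring
  exact ⟨norm_pos_iff.2 hne, hlt, S.isRegular_of_im_ne_zero hne hlt him⟩

/-! ### Special solutions -/

variable {S}

/-- At a regular point the coefficients of the special solution are unique. -/
theorem IsSpecialSolution.unique [Finite C] {σ ν : C} (hσν : σ ≠ ν) {ω : ℂ} (h0 : ω ≠ 0)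
    (hω : ‖ω‖ ≤ 1) (hreg : S.IsRegular ω) {ψ ψ' : A → ℂ} {s s' : C → ℂ}
    (h : S.IsSpecialSolution σ ω ψ s) (h' : S.IsSpecialSolution σ ω ψ' s') : s ν = s' ν := by
  have := Fintype.ofFinite C
  have hd := h.solution.sub h'.solution
  have hz : ψ - ψ' = 0 := by
    refine hreg _ hd fun γ => ?_
    by_cases hγ : γ = σ
    · subst hγ
      rcases (S.norm_theta_le γ h0 hω).lt_or_eq with hθ | hθ
      · have hθ0 := S.theta_ne_zero γ h0 hω
        -- The growing parts cancel, so the difference has growth coefficient `0`, that is, zero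
        -- Wronskian with the Jost solution; it is then a multiple of it.
        have hl := (h.growing hθ).sub (h'.growing hθ)
        rw [sub_self] at hl
        have hl' := IsChanSol.tendsto_mul_pow (σ := γ) hθ0 hθ
          (x := fun k => (ψ - ψ') (S.chan γ k)) (by rw [S.Wchan_theta γ h0 hω]; exact hd.chan γ)
        have heq := tendsto_nhds_unique hl' (hl.congr fun k => by rw [Pi.sub_apply, sub_div])
        have hne : S.theta γ ω ^ 2 - 1 ≠ 0 := by
          intro hh
          have h1 := pow_lt_one₀ (norm_nonneg _) hθ two_ne_zero
          rw [← norm_pow, sub_eq_zero.1 hh, norm_one] at h1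
          exact lt_irrefl _ h1
        have hw : S.wron γ (fun k => (ψ - ψ') (S.chan γ k)) (S.jostAt ω γ) 0 = 0 := by
          rcases div_eq_zero_iff.1 heq with h1 | h1
          · exact (mul_eq_zero.1 h1).resolve_right hθ0
          · exact absurd h1 (mul_ne_zero (S.bLim_ne_zero γ) hne)
        exact (hd.chan γ).eq_const_mul (S.isChanSol_jostAt h0 hω γ) (S.jostAt_ne_zero h0 hω γ) hw
      · refine ⟨s γ - s' γ, fun k => ?_⟩
        rw [Pi.sub_apply, h.incoming hθ, h'.incoming hθ]
        ring
    · refine ⟨s γ - s' γ, fun k => ?_⟩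
      rw [Pi.sub_apply, h.outgoing γ hγ, h'.outgoing γ hγ]
      ring
  obtain ⟨k, hk⟩ := Function.ne_iff.1 (S.jostAt_ne_zero h0 hω ν)
  have h1 := congrFun hz (S.chan ν k)
  rw [Pi.sub_apply, Pi.zero_apply, h.outgoing ν hσν.symm, h'.outgoing ν hσν.symm, ← sub_mul] at h1
  exact sub_eq_zero.1 ((mul_eq_zero.1 h1).resolve_right hk)

variable (S)

open Classical in
/-- The function with values `x` along the channel `σ` which vanishes elsewhere. -/
noncomputable def channelFn (σ : C) (x : ℕ → ℂ) : A → ℂ :=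
  S.glue (fun γ k => if γ = σ then x k else 0) 0

theorem channelFn_self (σ : C) (x : ℕ → ℂ) (k : ℕ) : S.channelFn σ x (S.chan σ k) = x k := by
  classical
  simp [channelFn, glue_chan]

theorem channelFn_of_ne {σ γ : C} (h : γ ≠ σ) (x : ℕ → ℂ) (k : ℕ) :
    S.channelFn σ x (S.chan γ k) = 0 := by
  classical
  simp [channelFn, glue_chan, h]

theorem channelFn_center (σ : C) (x : ℕ → ℂ) (α : S.center) (h : ∀ γ, α.1 ≠ S.chan γ 0) :
    S.channelFn σ x α = 0 := S.glue_center _ _ α h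

/-- The defect of `channelFn σ x` in the equation on the central part. -/
noncomputable def source [Fintype C] (σ : C) (x : ℕ → ℂ) (lam : ℂ) (α : S.center) : ℂ :=
  S.centerOp (S.channelFn σ x) α - lam * S.channelFn σ x α

variable {S}

/-- The incoming or growing sequence on `σ` fails the equation only in the centre, and an outgoing
function repairs that defect. On a closed channel the correction decays, so it leaves the leading
growth unchanged. -/
theorem isSpecialSolution_add [Fintype C] {σ : C} {ω : ℂ} (h0 : ω ≠ 0) (hω : ‖ω‖ ≤ 1)
    {x : ℕ → ℂ} (hx : S.IsChanSol σ (S.W ω) x) {v : S.center → ℂ}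
    (hv : S.centerMap (S.jostAt ω) (S.W ω) v = -S.source σ x (S.W ω))
    (h1 : ‖S.theta σ ω‖ = 1 → ∀ k, x k = S.jost σ k (S.theta σ ω)⁻¹)
    (h2 : ‖S.theta σ ω‖ < 1 → Tendsto (fun k => x k / (S.theta σ ω)⁻¹ ^ k) atTop (𝓝 1)) :
    S.IsSpecialSolution σ ω (S.channelFn σ x + S.extend (S.jostAt ω) v)
      (fun γ => v (S.port γ)) where
  solution := by
    refine S.isSolution_iff.2 ⟨fun γ => ?_, fun α hα => ?_⟩
    · by_cases hγ : γ = σ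
      · subst hγ
        simp only [Pi.add_apply, channelFn_self, extend_chan]
        exact hx.add ((S.isChanSol_jostAt h0 hω γ).const_mul _)
      · simp only [Pi.add_apply, S.channelFn_of_ne hγ, extend_chan, zero_add]
        exact (S.isChanSol_jostAt h0 hω γ).const_mul _
    · have h := congrFun hv ⟨α, hα⟩
      simp only [centerMap_apply, Pi.neg_apply, source] at h
      rw [map_add, Pi.add_apply, Pi.add_apply]
      linear_combination h
  outgoing γ hγ k := by
    simp only [Pi.add_apply, S.channelFn_of_ne hγ, extend_chan, zero_add]
    rfl
  incoming hθ k := by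
    simp only [Pi.add_apply, channelFn_self, extend_chan, h1 hθ]
    rfl
  growing hθ := by
    have h3 := (h2 hθ).add (((S.tendsto_jostAt_zero σ h0 hω hθ).const_mul (v (S.port σ))).mul
      (tendsto_pow_atTop_nhds_zero_of_norm_lt_one hθ))
    simp only [mul_zero, add_zero] at h3
    refine h3.congr fun k => ?_
    simp only [Pi.add_apply, channelFn_self, extend_chan, inv_pow, div_inv_eq_mul]
    ring

/-- At a regular point the special solution exists. -/
theorem exists_isSpecialSolution [Finite C] (σ : C) {ω : ℂ} (h0 : ω ≠ 0) (hω : ‖ω‖ ≤ 1)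
    (hreg : S.IsRegular ω) : ∃ ψ s, S.IsSpecialSolution σ ω ψ s := by
  have := Fintype.ofFinite C
  obtain ⟨x, hx, h1, h2⟩ : ∃ x, S.IsChanSol σ (S.W ω) x ∧
      (‖S.theta σ ω‖ = 1 → ∀ k, x k = S.jost σ k (S.theta σ ω)⁻¹) ∧
      (‖S.theta σ ω‖ < 1 → Tendsto (fun k => x k / (S.theta σ ω)⁻¹ ^ k) atTop (𝓝 1)) := by
    rcases (S.norm_theta_le σ h0 hω).lt_or_eq with hθ | hθ
    · obtain ⟨x, hx, hx1, -⟩ := S.exists_growing h0 hω σ hθ (S.jostAt_wron_ne_zero h0 hω σ)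
      exact ⟨x, hx, fun h => absurd h hθ.ne, fun _ => hx1⟩
    · refine ⟨fun k => S.jost σ k (S.theta σ ω)⁻¹, ?_, fun _ _ => rfl, fun h => absurd hθ h.ne⟩
      have hj := (S.isJost_jost σ (inv_ne_zero (S.theta_ne_zero σ h0 hω))
        (by rw [norm_inv, hθ, inv_one])).isChanSol
      have hW : S.Wchan σ (S.theta σ ω)⁻¹ = S.W ω := by
        rw [← S.Wchan_theta σ h0 hω]
        unfold Wchan
        rw [inv_inv, add_comm (S.theta σ ω)⁻¹]
      rwa [hW] at hj
  obtain ⟨v, hv⟩ := LinearMap.injective_iff_surjective.1 (S.centerMap_injective h0 hω hreg)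
    (-S.source σ x (S.W ω))
  exact ⟨_, _, isSpecialSolution_add h0 hω hx hv h1 h2⟩

theorem IsSpecialSolution.regularCoeff_eq [Finite C] {σ ν : C} (hσν : σ ≠ ν) {ω : ℂ} (h0 : ω ≠ 0)
    (hω : ‖ω‖ ≤ 1) (hreg : S.IsRegular ω) {ψ : A → ℂ} {s : C → ℂ}
    (h : S.IsSpecialSolution σ ω ψ s) : S.regularCoeff ν σ ω = s ν := by
  refine theOrZero_eq ⟨ψ, s, h, rfl⟩ ?_
  rintro z ⟨ψ', s', h', rfl⟩
  exact h'.unique hσν h0 hω hreg h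

/-! ### Symmetry with respect to complex conjugation -/

theorem IsRegular.conj [Finite C] {ω : ℂ} (h0 : ω ≠ 0) (hω : ‖ω‖ ≤ 1) (h : S.IsRegular ω) :
    S.IsRegular ((starRingEnd ℂ) ω) := by
  intro ξ hξ hout
  have h1 := hξ.conj
  rw [W_conj, Complex.conj_conj] at h1
  have h2 := h _ h1 fun γ => by
    obtain ⟨c, hc⟩ := hout γ
    refine ⟨(starRingEnd ℂ) c, fun k => ?_⟩
    have : S.jost γ k (S.theta γ ((starRingEnd ℂ) ω)) =
        (starRingEnd ℂ) (S.jost γ k (S.theta γ ω)) :=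
      S.jostAt_conj h0 hω γ k
    rw [hc k, map_mul, this, Complex.conj_conj]
  funext α
  have := congrFun h2 α
  simpa using this

theorem isRegular_conj_iff [Finite C] {ω : ℂ} (h0 : ω ≠ 0) (hω : ‖ω‖ ≤ 1) :
    S.IsRegular ((starRingEnd ℂ) ω) ↔ S.IsRegular ω := by
  refine ⟨fun h => ?_, fun h => h.conj h0 hω⟩
  have := h.conj (by simpa using h0) (by simpa using hω)
  rwa [Complex.conj_conj] at this

theorem IsSpecialSolution.conj [Finite C] {σ : C} {ω : ℂ} (h0 : ω ≠ 0) (hω : ‖ω‖ ≤ 1)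
    {ψ : A → ℂ} {s : C → ℂ} (h : S.IsSpecialSolution σ ω ψ s) :
    S.IsSpecialSolution σ ((starRingEnd ℂ) ω) (fun α => (starRingEnd ℂ) (ψ α))
      (fun γ => (starRingEnd ℂ) (s γ)) where
  solution := by
    rw [W_conj]
    exact h.solution.conj
  outgoing γ hγ k := by
    rw [h.outgoing γ hγ, map_mul]
    congr 1
    exact (S.jostAt_conj h0 hω γ k).symm
  incoming hθ k := by
    rw [S.theta_conj σ h0 hω, RCLike.norm_conj] at hθ
    have h1 := S.theta_ne_zero σ h0 hω
    rw [h.incoming hθ, map_add, map_mul, S.theta_conj σ h0 hω, ← map_inv₀,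
      S.jost_conj σ k (inv_ne_zero h1) (by rw [norm_inv, hθ, inv_one]),
      S.jost_conj σ k h1 hθ.le]
  growing hθ := by
    rw [S.theta_conj σ h0 hω] at hθ ⊢
    rw [RCLike.norm_conj] at hθ
    have := (Complex.continuous_conj.tendsto _).comp (h.growing hθ)
    simpa [Function.comp_def] using this

theorem regularCoeff_conj [Finite C] {σ ν : C} (hσν : σ ≠ ν) {ω : ℂ} (h0 : ω ≠ 0) (hω : ‖ω‖ ≤ 1)
    (hreg : S.IsRegular ω) :
    S.regularCoeff ν σ ((starRingEnd ℂ) ω) = (starRingEnd ℂ) (S.regularCoeff ν σ ω) := by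
  obtain ⟨ψ, s, h⟩ := exists_isSpecialSolution σ h0 hω hreg
  rw [h.regularCoeff_eq hσν h0 hω hreg,
    (h.conj h0 hω).regularCoeff_eq hσν (by simpa using h0) (by simpa using hω) (hreg.conj h0 hω)]

theorem IsScatteringCoeff.unique [Finite C] {σ ν : C} (hσν : σ ≠ ν) {ω z z' : ℂ} (hω : ‖ω‖ = 1)
    (h : S.IsScatteringCoeff ν σ ω z) (h' : S.IsScatteringCoeff ν σ ω z') : z = z' := by
  have h0 : ω ≠ 0 := by rintro rfl; simp at hω
  have : Nonempty C := ⟨σ⟩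
  rcases h with ⟨hr, ψ, s, h, rfl⟩ | ⟨hr, h⟩ <;> rcases h' with ⟨hr', ψ', s', h', rfl⟩ | ⟨hr', h'⟩
  · exact h.unique hσν h0 hω.le hr h'
  · exact absurd hr hr'
  · exact absurd hr' hr
  · have := S.neBot_regular hω
    exact tendsto_nhds_unique h h'

theorem IsScatteringCoeff.conj [Finite C] {σ ν : C} (hσν : σ ≠ ν) {ω z : ℂ} (hω : ‖ω‖ = 1)
    (h : S.IsScatteringCoeff ν σ ω z) :
    S.IsScatteringCoeff ν σ ((starRingEnd ℂ) ω) ((starRingEnd ℂ) z) := by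
  have h0 : ω ≠ 0 := by rintro rfl; simp at hω
  rcases h with ⟨hr, ψ, s, h, rfl⟩ | ⟨hr, h⟩
  · exact Or.inl ⟨hr.conj h0 hω.le, _, _, h.conj h0 hω.le, rfl⟩
  · refine Or.inr ⟨fun h1 => hr ((isRegular_conj_iff h0 hω.le).1 h1), ?_⟩
    have hmap : Tendsto (starRingEnd ℂ)
        (𝓝[{w | 0 < ‖w‖ ∧ ‖w‖ < 1 ∧ S.IsRegular w}] ((starRingEnd ℂ) ω))
        (𝓝[{w | 0 < ‖w‖ ∧ ‖w‖ < 1 ∧ S.IsRegular w}] ω) := by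
      refine tendsto_nhdsWithin_iff.2 ⟨?_, ?_⟩
      · have := (Complex.continuous_conj.tendsto ((starRingEnd ℂ) ω)).mono_left
          (nhdsWithin_le_nhds (s := {w | 0 < ‖w‖ ∧ ‖w‖ < 1 ∧ S.IsRegular w}))
        rwa [Complex.conj_conj] at this
      · filter_upwards [self_mem_nhdsWithin] with w hw
        exact ⟨by simpa using hw.1, by simpa using hw.2.1,
          hw.2.2.conj (norm_pos_iff.1 hw.1) hw.2.1.le⟩
    refine ((Complex.continuous_conj.tendsto z).comp (h.comp hmap)).congr' ?_
    filter_upwards [self_mem_nhdsWithin] with w hw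
    simp only [Function.comp_apply]
    rw [regularCoeff_conj hσν (norm_pos_iff.1 hw.1) hw.2.1.le hw.2.2, Complex.conj_conj]

/-- Existence of a value is itself invariant under conjugation, so the default value `0` occurs at
`ω` and at its conjugate together. -/
theorem scattering_conj [Finite C] {σ ν : C} (hσν : σ ≠ ν) {ω : ℂ} (hω : ‖ω‖ = 1) :
    S.scattering ν σ ((starRingEnd ℂ) ω) = (starRingEnd ℂ) (S.scattering ν σ ω) := by
  have hω' : ‖(starRingEnd ℂ) ω‖ = 1 := by simpa using hω
  by_cases h : ∃ z, S.IsScatteringCoeff ν σ ω z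
  · have h1 : S.IsScatteringCoeff ν σ ω (S.scattering ν σ ω) := theOrZero_spec h
    exact theOrZero_eq (h1.conj hσν hω) fun y hy => hy.unique hσν hω' (h1.conj hσν hω)
  · have h' : ¬ ∃ z, S.IsScatteringCoeff ν σ ((starRingEnd ℂ) ω) z := by
      rintro ⟨z, hz⟩
      have := hz.conj hσν hω'
      rw [Complex.conj_conj] at this
      exact h ⟨_, this⟩
    rw [scattering, scattering, theOrZero_of_not_exists h, theOrZero_of_not_exists h', map_zero]

end WebSystem

/-! ### Perturbation of injective linear systems -/

/-- Solutions of linear systems depend continuously on the data if the limit system is injective. -/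
theorem exists_tendsto_of_injective {X ι Z : Type*} [Fintype ι] [NormedAddCommGroup Z]
    [NormedSpace ℂ Z] [FiniteDimensional ℂ Z] {l : Filter X} {T : X → (ι → ℂ) →ₗ[ℂ] Z}
    {T₀ : (ι → ℂ) →ₗ[ℂ] Z} (hinj : Function.Injective T₀)
    (hT : ∀ v, Tendsto (fun w => T w v) l (𝓝 (T₀ v))) {v : X → ι → ℂ} {F : X → Z} {F₀ : Z}
    (hv : ∀ᶠ w in l, T w (v w) = F w) (hF : Tendsto F l (𝓝 F₀)) : ∃ v₀, Tendsto v l (𝓝 v₀) := by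
  classical
  -- The system may be overdetermined. A left inverse `Q` of the limit makes it square, with
  -- matrices `Q ∘ T w → 1`, and Cramer's rule then gives convergence.
  obtain ⟨Q, hQ⟩ := T₀.exists_leftInverse_of_injective (LinearMap.ker_eq_bot.2 hinj)
  have hQc : Continuous Q := Q.continuous_of_finiteDimensional
  have hQF : Tendsto (fun w => Q (F w)) l (𝓝 (Q F₀)) := (hQc.tendsto _).comp hF
  set M : X → Matrix ι ι ℂ := fun w => LinearMap.toMatrix' (Q ∘ₗ T w) with hM
  have hM1 : Tendsto M l (𝓝 1) := by
    refine tendsto_pi_nhds.2 fun i => tendsto_pi_nhds.2 fun j => ?_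
    have h1 := (hQc.tendsto _).comp (hT (Pi.single j 1))
    have h2 := (tendsto_pi_nhds.1 h1) i
    have h3 : Q (T₀ (Pi.single j 1)) = Pi.single j 1 := LinearMap.congr_fun hQ _
    rw [h3] at h2
    have h4 : (1 : Matrix ι ι ℂ) i j = (Pi.single j 1 : ι → ℂ) i := by
      rw [Matrix.one_apply, Pi.single_apply]
    rw [h4]
    refine h2.congr fun w => ?_
    simp [hM, LinearMap.toMatrix'_apply]
  have hdet : Tendsto (fun w => (M w).det) l (𝓝 1) := by
    have h : Tendsto (fun N : Matrix ι ι ℂ => N.det) (𝓝 1) (𝓝 1) := by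
      simpa using (continuous_id.matrix_det).tendsto (1 : Matrix ι ι ℂ)
    exact h.comp hM1
  have hadj : Tendsto (fun w => (M w).adjugate) l (𝓝 1) := by
    have h : Tendsto (fun N : Matrix ι ι ℂ => N.adjugate) (𝓝 1) (𝓝 1) := by
      simpa using (continuous_id.matrix_adjugate).tendsto (1 : Matrix ι ι ℂ)
    exact h.comp hM1
  have hlim : Tendsto (fun w => ((M w).det)⁻¹ • ((M w).adjugate).mulVec (Q (F w))) l
      (𝓝 ((1 : ℂ)⁻¹ • (1 : Matrix ι ι ℂ).mulVec (Q F₀))) := by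
    refine (hdet.inv₀ one_ne_zero).smul ?_
    refine tendsto_pi_nhds.2 fun i => ?_
    simp only [Matrix.mulVec, dotProduct]
    refine tendsto_finsetSum _ fun j _ => ?_
    exact ((tendsto_pi_nhds.1 (tendsto_pi_nhds.1 hadj i)) j).mul ((tendsto_pi_nhds.1 hQF) j)
  refine ⟨_, hlim.congr' ?_⟩
  filter_upwards [hv, hdet.eventually_ne one_ne_zero] with w hw hd
  have h1 : (M w).mulVec (v w) = Q (F w) := by
    rw [hM, LinearMap.toMatrix'_mulVec, LinearMap.comp_apply, hw]
  rw [← h1, Matrix.mulVec_mulVec, Matrix.adjugate_mul, Matrix.smul_mulVec, Matrix.one_mulVec,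
    smul_smul, inv_mul_cancel₀ hd, one_smul]

namespace WebSystem

variable {A C : Type*} (S : WebSystem A C)

/-! ### Outgoing solutions on the unit circle -/

theorem conj_eq_inv_of_norm_eq_one {z : ℂ} (hz : ‖z‖ = 1) : (starRingEnd ℂ) z = z⁻¹ := by
  rw [Complex.inv_def, Complex.normSq_eq_norm_sq, hz]
  simp

/-- Away from the band edges, an outgoing solution vanishes on the open channels. -/
theorem coeff_eq_zero_of_open [Finite C] {ω : ℂ} (hω : ‖ω‖ = 1) (he : ¬ S.IsBandEdge ω)
    {ξ : A → ℂ} (hξ : S.IsSolution (S.W ω) ξ) {c : C → ℂ}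
    (hc : ∀ γ k, ξ (S.chan γ k) = c γ * S.jostAt ω γ k) {γ : C} (hγ : ‖S.theta γ ω‖ = 1) :
    c γ = 0 := by
  classical
  have := Fintype.ofFinite C
  have : Nonempty C := ⟨γ⟩
  have h0 : ω ≠ 0 := by rintro rfl; simp at hω
  have hξ' := hξ.conj
  have hreal : (starRingEnd ℂ) (S.W ω) = S.W ω := by
    rw [S.W_of_norm_eq_one hω, Complex.conj_ofReal]
  rw [hreal] at hξ'
  have hg := S.green hξ hξ'
  rw [sub_self, zero_mul] at hg
  set w : C → ℂ := fun γ => S.wron γ (fun k => ξ (S.chan γ k))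
    (fun k => (starRingEnd ℂ) (ξ (S.chan γ k))) 0 with hw
  have hlim : ∀ γ l, Tendsto (S.wron γ (fun k => ξ (S.chan γ k))
      (fun k => (starRingEnd ℂ) (ξ (S.chan γ k)))) atTop (𝓝 l) → w γ = l := fun γ l hl =>
    tendsto_nhds_unique tendsto_const_nhds
      (hl.congr fun k => (hξ.chan γ).wron_eq (hξ'.chan γ) k)
  have hclosed : ∀ γ, ‖S.theta γ ω‖ < 1 → w γ = 0 := by
    intro γ hγ
    have h1 : Tendsto (fun k => ξ (S.chan γ k)) atTop (𝓝 0) := by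
      have := (S.tendsto_jostAt_zero γ h0 hω.le hγ).const_mul (c γ)
      rw [mul_zero] at this
      exact this.congr fun k => (hc γ k).symm
    have h2 : Tendsto (fun k => (starRingEnd ℂ) (ξ (S.chan γ k))) atTop (𝓝 0) := by
      have := (Complex.continuous_conj.tendsto _).comp h1
      rwa [map_zero] at this
    refine hlim γ 0 (tendsto_wron_zero ?_ ?_)
    · simpa using h1.mul (h2.comp (tendsto_add_atTop_nat 1))
    · simpa using (h1.comp (tendsto_add_atTop_nat 1)).mul h2
  -- The Wronskian is `b |c|² (conj θ - θ) = -2i b |c|² Im θ`; the extra factor makes every open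
  -- contribution real and nonnegative.
  have hopen : ∀ γ, ‖S.theta γ ω‖ = 1 → w γ * (Complex.I / 2 * ω.im) =
      ((S.bLim γ * Complex.normSq (c γ) * ((S.theta γ ω).im * ω.im) : ℝ) : ℂ) := by
    intro γ hγ
    have hθ0 := S.theta_ne_zero γ h0 hω.le
    have h1 : Tendsto (fun k => ξ (S.chan γ k) / S.theta γ ω ^ k) atTop (𝓝 (c γ)) := by
      have := (S.isJost_jostAt h0 hω.le γ).2.const_mul (c γ)
      rw [mul_one] at this
      refine this.congr fun k => ?_
      rw [hc γ k, mul_div_assoc]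
    have h2 : Tendsto (fun k => (starRingEnd ℂ) (ξ (S.chan γ k)) / (S.theta γ ω)⁻¹ ^ k) atTop
        (𝓝 ((starRingEnd ℂ) (c γ))) := by
      have := (Complex.continuous_conj.tendsto _).comp h1
      rw [← conj_eq_inv_of_norm_eq_one hγ]
      simpa [Function.comp_def] using this
    rw [hlim γ _ (tendsto_wron hθ0 (inv_mul_cancel₀ hθ0) h1 h2), Complex.mul_conj,
      ← conj_eq_inv_of_norm_eq_one hγ]
    have h3 : (starRingEnd ℂ) (S.theta γ ω) - S.theta γ ω =
        -(2 * (S.theta γ ω).im * Complex.I) := by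
      rw [← neg_sub, Complex.sub_conj]
      push_cast
      ring
    rw [h3]
    push_cast
    linear_combination (-(S.bLim γ : ℂ) * Complex.normSq (c γ) * (S.theta γ ω).im * ω.im) *
      Complex.I_mul_I
  set f : C → ℝ := fun γ => if ‖S.theta γ ω‖ = 1 then
    S.bLim γ * Complex.normSq (c γ) * ((S.theta γ ω).im * ω.im) else 0 with hf
  have hwf : ∀ γ, w γ * (Complex.I / 2 * ω.im) = f γ := by
    intro γ
    simp only [hf]
    split_ifs with h
    · exact hopen γ h
    · rw [hclosed γ (lt_of_le_of_ne (S.norm_theta_le γ h0 hω.le) h)]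
      simp
  have hsum : ∑ γ, f γ = 0 := by
    have : ((∑ γ, f γ : ℝ) : ℂ) = 0 := by
      push_cast
      rw [← Finset.sum_congr rfl fun γ _ => hwf γ, ← Finset.sum_mul, ← hg, zero_mul]
    exact_mod_cast this
  have hfn : ∀ γ ∈ Finset.univ, 0 ≤ f γ := by
    intro γ _
    simp only [hf]
    split_ifs with h
    · exact mul_nonneg (mul_nonneg (S.bLim_pos γ).le (Complex.normSq_nonneg _))
        (S.theta_im_mul_im_pos γ hω he h).le
    · exact le_rfl
  have h1 := (Finset.sum_eq_zero_iff_of_nonneg hfn).1 hsum γ (Finset.mem_univ γ)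
  simp only [hf, if_pos hγ] at h1
  rcases mul_eq_zero.1 h1 with h2 | h2
  · exact Complex.normSq_eq_zero.1 ((mul_eq_zero.1 h2).resolve_left (S.bLim_pos γ).ne')
  · exact absurd h2 (S.theta_im_mul_im_pos γ hω he hγ).ne'

/-! ### The pairing with outgoing functions -/

/-- The pairing of `extend e v` with the complex conjugate of `extend e' u`, as a function of
`v`. -/
noncomputable def jostPairing [Fintype C] (e e' : C → ℕ → ℂ) (u : S.center → ℂ) :
    (S.center → ℂ) →ₗ[ℂ] ℂ :=
  ∑ α ∈ S.center, (starRingEnd ℂ) (S.extend e' u α) • (LinearMap.proj α ∘ₗ S.extend e) +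
    ∑ γ, ((starRingEnd ℂ) (u (S.port γ)) *
      ∑' k, e γ (k + 1) * (starRingEnd ℂ) (e' γ (k + 1))) • LinearMap.proj (S.port γ)

theorem jostPairing_apply [Fintype C] (e e' : C → ℕ → ℂ) (u v : S.center → ℂ) :
    S.jostPairing e e' u v =
      ∑ α ∈ S.center, (starRingEnd ℂ) (S.extend e' u α) * S.extend e v α +
      ∑ γ, ((starRingEnd ℂ) (u (S.port γ)) *
        ∑' k, e γ (k + 1) * (starRingEnd ℂ) (e' γ (k + 1))) * v (S.port γ) := by
  simp [jostPairing]

theorem jostPairing_eq_pairing [Fintype C] (e e' : C → ℕ → ℂ) (u v : S.center → ℂ) :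
    S.jostPairing e e' u v =
      S.pairing (S.extend e v) (fun α => (starRingEnd ℂ) (S.extend e' u α)) := by
  rw [jostPairing_apply, pairing]
  congr 1
  · exact Finset.sum_congr rfl fun α _ => mul_comm _ _
  · refine Finset.sum_congr rfl fun γ _ => ?_
    rw [mul_right_comm, ← tsum_mul_left]
    refine tsum_congr fun k => ?_
    rw [extend_chan, extend_chan, map_mul]
    ring

/-- The functions `u` whose pairing with `v` vanishes. -/
noncomputable def jostOrthogonal [Fintype C] (e e' : C → ℕ → ℂ) (v : S.center → ℂ) :
    Submodule ℂ (S.center → ℂ) where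
  carrier := {u | S.jostPairing e e' u v = 0}
  zero_mem' := by simp [jostPairing_apply]
  add_mem' {u u'} hu hu' := by
    simp only [Set.mem_ofPred_eq, jostPairing_apply] at hu hu' ⊢
    simp only [map_add, Pi.add_apply, add_mul, Finset.sum_add_distrib]
    linear_combination hu + hu'
  smul_mem' a u hu := by
    simp only [Set.mem_ofPred_eq, jostPairing_apply] at hu ⊢
    simp only [map_smul, Pi.smul_apply, smul_eq_mul, map_mul, mul_assoc, ← Finset.mul_sum] at hu ⊢
    linear_combination (starRingEnd ℂ) a * hu

/-! ### Boundary limits of the scattering coefficients -/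

theorem tendsto_centerOp [Fintype C] {X : Type*} {l : Filter X} {ξ : X → A → ℂ} {ξ₀ : A → ℂ}
    (h : ∀ α ∈ S.center, Tendsto (fun w => ξ w α) l (𝓝 (ξ₀ α)))
    (h1 : ∀ γ, Tendsto (fun w => ξ w (S.chan γ 1)) l (𝓝 (ξ₀ (S.chan γ 1)))) (α : A) :
    Tendsto (fun w => S.centerOp (ξ w) α) l (𝓝 (S.centerOp ξ₀ α)) := by
  simp only [centerOp_apply]
  refine (tendsto_finsetSum _ fun β hβ => (h β hβ).const_mul _).add
    (tendsto_finsetSum _ fun γ _ => ?_)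
  split_ifs
  · exact (h1 γ).const_mul _
  · exact tendsto_const_nhds

theorem tendsto_center {X : Type*} {l : Filter X} {ξ : X → A → ℂ} {ξ₀ : A → ℂ}
    (h : ∀ γ, Tendsto (fun w => ξ w (S.chan γ 0)) l (𝓝 (ξ₀ (S.chan γ 0))))
    (h1 : ∀ α : S.center, (∀ γ, α.1 ≠ S.chan γ 0) → ∀ w, ξ w α = ξ₀ α) (α : A)
    (hα : α ∈ S.center) : Tendsto (fun w => ξ w α) l (𝓝 (ξ₀ α)) := by
  by_cases hc : ∃ γ, α = S.chan γ 0
  · obtain ⟨γ, rfl⟩ := hc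
    exact h γ
  · push Not at hc
    exact tendsto_const_nhds.congr fun w => (h1 ⟨α, hα⟩ hc w).symm

theorem tendsto_extend_center {X : Type*} {l : Filter X} {e : X → C → ℕ → ℂ} {e₀ : C → ℕ → ℂ}
    (h : ∀ γ k, Tendsto (fun w => e w γ k) l (𝓝 (e₀ γ k))) (v : S.center → ℂ) (α : A)
    (hα : α ∈ S.center) : Tendsto (fun w => S.extend (e w) v α) l (𝓝 (S.extend e₀ v α)) := by
  refine S.tendsto_center (fun γ => ?_) (fun β hβ w => ?_) α hα
  · simp only [extend_chan]
    exact (h γ 0).const_mul _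
  · rw [S.extend_center _ _ _ hβ, S.extend_center _ _ _ hβ]

theorem tendsto_centerMap [Fintype C] {X : Type*} {l : Filter X} {e : X → C → ℕ → ℂ}
    {e₀ : C → ℕ → ℂ} (h : ∀ γ k, Tendsto (fun w => e w γ k) l (𝓝 (e₀ γ k))) {lam : X → ℂ}
    {lam₀ : ℂ} (hl : Tendsto lam l (𝓝 lam₀)) (v : S.center → ℂ) :
    Tendsto (fun w => S.centerMap (e w) (lam w) v) l (𝓝 (S.centerMap e₀ lam₀ v)) := by
  rw [tendsto_pi_nhds]
  intro α
  simp only [centerMap_apply]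
  have h1 := S.tendsto_extend_center h v
  refine (S.tendsto_centerOp h1 (fun γ => ?_) α).sub (hl.mul (h1 α α.2))
  simp only [extend_chan]
  exact (h γ 1).const_mul _

theorem tendsto_source [Fintype C] {X : Type*} {l : Filter X} (σ : C) {x : X → ℕ → ℂ} {x₀ : ℕ → ℂ}
    (h : ∀ k ≤ 1, Tendsto (fun w => x w k) l (𝓝 (x₀ k))) {lam : X → ℂ} {lam₀ : ℂ}
    (hl : Tendsto lam l (𝓝 lam₀)) :
    Tendsto (fun w => S.source σ (x w) (lam w)) l (𝓝 (S.source σ x₀ lam₀)) := by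
  have h2 : ∀ k ≤ 1, ∀ γ, Tendsto (fun w => S.channelFn σ (x w) (S.chan γ k)) l
      (𝓝 (S.channelFn σ x₀ (S.chan γ k))) := by
    intro k hk γ
    by_cases hγ : γ = σ
    · subst hγ
      simp only [channelFn_self]
      exact h k hk
    · simp only [S.channelFn_of_ne hγ]
      exact tendsto_const_nhds
  have h1 : ∀ α ∈ S.center, Tendsto (fun w => S.channelFn σ (x w) α) l
      (𝓝 (S.channelFn σ x₀ α)) :=
    S.tendsto_center (h2 0 zero_le_one) fun α hα w => by
      rw [S.channelFn_center _ _ _ hα, S.channelFn_center _ _ _ hα]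
  rw [tendsto_pi_nhds]
  intro α
  exact (S.tendsto_centerOp h1 (h2 1 le_rfl) α).sub (hl.mul (h1 α α.2))

/-- On channels open at `ω` the Jost solutions need not be summable, but there the coefficient of
`u` is `0`. On the others `S.jostAt ω` is summable and dominates, up to a constant. -/
theorem tendsto_jostPairing [Fintype C] {ω : ℂ} (hω : ‖ω‖ = 1) {u : S.center → ℂ}
    (hu : ∀ γ, ‖S.theta γ ω‖ = 1 → u (S.port γ) = 0) {l : Filter ℂ}
    (hl : l ≤ 𝓝[{w | w ≠ 0 ∧ ‖w‖ ≤ 1}] ω) (v : S.center → ℂ) :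
    Tendsto (fun w => S.jostPairing (S.jostAt w) (S.jostAt ω) u v) l
      (𝓝 (S.jostPairing (S.jostAt ω) (S.jostAt ω) u v)) := by
  have h0 : ω ≠ 0 := by rintro rfl; simp at hω
  have hj : ∀ γ k, Tendsto (fun w => S.jostAt w γ k) l (𝓝 (S.jostAt ω γ k)) := fun γ k =>
    (S.continuousOn_jost_theta γ k ω ⟨h0, hω.le⟩).mono_left hl
  simp only [jostPairing_apply]
  refine (tendsto_finsetSum _ fun α hα => (S.tendsto_extend_center hj v α hα).const_mul _).add
    (tendsto_finsetSum _ fun γ _ => ?_)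
  rcases (S.norm_theta_le γ h0 hω.le).lt_or_eq with hγ | hγ
  · refine (Tendsto.const_mul _ ?_).mul_const _
    obtain ⟨K, hK, hb⟩ := S.exists_jostAt_bound γ
    refine tendsto_tsum_of_dominated_convergence
      ((S.summable_norm_jostAt γ h0 hω.le hγ).mul_left K) (fun k => (hj γ (k + 1)).mul_const _) ?_
    filter_upwards [hl self_mem_nhdsWithin] with w hw k
    rw [norm_mul, RCLike.norm_conj]
    gcongr
    refine (hb w (k + 1) hw.1 hw.2).trans (mul_le_of_le_one_right hK ?_)
    exact pow_le_one₀ (norm_nonneg _) (S.norm_theta_le γ hw.1 hw.2)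
  · simpa [hu γ hγ] using tendsto_const_nhds

/-- The special solution which corresponds to an open channel is orthogonal to the outgoing
solutions at a boundary point. -/
theorem jostPairing_eq_zero [Fintype C] {σ : C} {ω : ℂ} (hω : ‖ω‖ = 1) {u : S.center → ℂ}
    (hu : ∀ γ, ‖S.theta γ ω‖ = 1 → u (S.port γ) = 0)
    (hker : S.centerMap (S.jostAt ω) (S.W ω) u = 0) (hσ : ‖S.theta σ ω‖ = 1) {w : ℂ} (hw0 : w ≠ 0)
    (hw : ‖w‖ < 1) {x : ℕ → ℂ} {v : S.center → ℂ}
    (hψ : S.IsSolution (S.W w) (S.channelFn σ x + S.extend (S.jostAt w) v)) :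
    S.jostPairing (S.jostAt w) (S.jostAt ω) u v = 0 := by
  have h0 : ω ≠ 0 := by rintro rfl; simp at hω
  set η : A → ℂ := fun α => (starRingEnd ℂ) (S.extend (S.jostAt ω) u α) with hη
  have hηsol : S.IsSolution (S.W ω) η := by
    have := (S.isSolution_extend (fun γ => S.isChanSol_jostAt h0 hω.le γ) hker).conj
    rwa [S.W_of_norm_eq_one hω, Complex.conj_ofReal, ← S.W_of_norm_eq_one hω] at this
  have hηchan : ∀ γ k, η (S.chan γ k) =
      (starRingEnd ℂ) (u (S.port γ)) * (starRingEnd ℂ) (S.jostAt ω γ k) := by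
    intro γ k
    simp only [hη, extend_chan, map_mul]
  have hηopen : ∀ γ k, ‖S.theta γ ω‖ = 1 → η (S.chan γ k) = 0 := by
    intro γ k hγ
    rw [hηchan, hu γ hγ, map_zero, zero_mul]
  have hηsum : ∀ γ, Summable fun k => ‖η (S.chan γ (k + 1))‖ := by
    intro γ
    rcases (S.norm_theta_le γ h0 hω.le).lt_or_eq with hγ | hγ
    · refine ((S.summable_norm_jostAt γ h0 hω.le hγ).mul_left ‖u (S.port γ)‖).congr fun k => ?_
      rw [hηchan, norm_mul, RCLike.norm_conj, RCLike.norm_conj]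
    · simp only [hηopen γ _ hγ, norm_zero]
      exact summable_zero
  have hηlim : ∀ γ, Tendsto (fun k => η (S.chan γ k)) atTop (𝓝 0) := fun γ =>
    (tendsto_add_atTop_iff_nat 1).1 (tendsto_zero_iff_norm_tendsto_zero.2
      (hηsum γ).tendsto_atTop_zero)
  -- The growing part lives on `σ`, where `η` vanishes because `σ` is open at `ω`; only the decaying
  -- part enters the pairing.
  have hchanη : ∀ α, S.channelFn σ x α * η α = 0 := by
    have : (fun α => S.channelFn σ x α * η α) = fun _ => 0 := by
      refine S.ext_chan_center (fun γ k => ?_) (fun α hα => ?_)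
      · by_cases hγ : γ = σ
        · subst hγ
          rw [hηopen γ k hσ, mul_zero]
        · rw [S.channelFn_of_ne hγ, zero_mul]
      · rw [S.channelFn_center _ _ _ hα, zero_mul]
    exact congrFun this
  have hψη : ∀ α, (S.channelFn σ x + S.extend (S.jostAt w) v) α * η α =
      S.extend (S.jostAt w) v α * η α := by
    intro α
    rw [Pi.add_apply, add_mul, hchanη, zero_add]
  have hbound : ∀ γ, ∃ M, ∀ k, ‖S.extend (S.jostAt w) v (S.chan γ k)‖ ≤ M := by
    intro γ
    obtain ⟨K, hK, hb⟩ := S.exists_jostAt_bound γ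
    refine ⟨‖v (S.port γ)‖ * K, fun k => ?_⟩
    rw [extend_chan, norm_mul]
    gcongr
    refine (hb w k hw0 hw.le).trans (mul_le_of_le_one_right hK ?_)
    exact pow_le_one₀ (norm_nonneg _) (S.norm_theta_le γ hw0 hw.le)
  have key := S.mul_pairing_eq_zero hψ hηsol ?_ ?_
  · have h1 := (mul_eq_zero.1 key).resolve_left (sub_ne_zero.2 (S.W_ne_of_norm_lt σ hw0 hw hω))
    rw [jostPairing_eq_pairing, ← h1]
    simp only [pairing, hψη]
    rfl
  · intro γ
    simp only [hψη]
    obtain ⟨M, hM⟩ := hbound γ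
    refine ((hηsum γ).mul_left M).of_norm_bounded fun k => ?_
    rw [norm_mul]
    gcongr
    exact hM _
  · intro γ
    by_cases hγ : γ = σ
    · subst hγ
      refine tendsto_const_nhds.congr fun k => ?_
      simp [wron, hηopen γ _ hσ]
    · obtain ⟨M, hM⟩ := hbound γ
      have hprod : ∀ i j, Tendsto (fun k => (S.channelFn σ x + S.extend (S.jostAt w) v)
          (S.chan γ (k + i)) * η (S.chan γ (k + j))) atTop (𝓝 0) := by
        intro i j
        have h1 := ((hηlim γ).comp (tendsto_add_atTop_nat j)).norm.const_mul M
        rw [norm_zero, mul_zero] at h1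
        refine squeeze_zero_norm (fun k => ?_) h1
        rw [Pi.add_apply, S.channelFn_of_ne hγ, zero_add, norm_mul]
        exact mul_le_mul_of_nonneg_right (hM _) (norm_nonneg _)
      exact tendsto_wron_zero (hprod 0 1) (hprod 1 0)

/-- Away from the band edges, the scattering coefficients of an open channel have boundary
limits. -/
theorem exists_tendsto_regularCoeff [Finite C] {σ ν : C} (hσν : σ ≠ ν) {ω : ℂ} (hω : ‖ω‖ = 1)
    (he : ¬ S.IsBandEdge ω) (hσ : ‖S.theta σ ω‖ = 1) :
    ∃ z, Tendsto (S.regularCoeff ν σ)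
      (𝓝[{w | 0 < ‖w‖ ∧ ‖w‖ < 1 ∧ S.IsRegular w}] ω) (𝓝 z) := by
  classical
  have := Fintype.ofFinite C
  have h0 : ω ≠ 0 := by rintro rfl; simp at hω
  set D : Set ℂ := {w | 0 < ‖w‖ ∧ ‖w‖ < 1 ∧ S.IsRegular w} with hD
  have hl : 𝓝[D] ω ≤ 𝓝[{w | w ≠ 0 ∧ ‖w‖ ≤ 1}] ω :=
    nhdsWithin_mono _ fun w hw => ⟨norm_pos_iff.1 hw.1, hw.2.1.le⟩
  have hj : ∀ γ k, Tendsto (fun w => S.jostAt w γ k) (𝓝[D] ω) (𝓝 (S.jostAt ω γ k)) := fun γ k =>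
    (S.continuousOn_jost_theta γ k ω ⟨h0, hω.le⟩).mono_left hl
  have hθ : Tendsto (S.theta σ) (𝓝[D] ω) (𝓝 (S.theta σ ω)) :=
    (S.continuousOn_theta σ ω ⟨h0, hω.le⟩).mono_left hl
  have hθ0 := S.theta_ne_zero σ h0 hω.le
  have hW : Tendsto S.W (𝓝[D] ω) (𝓝 (S.W ω)) :=
    (S.continuousAt_W h0).tendsto.mono_left nhdsWithin_le_nhds
  -- growing solutions whose initial values converge
  obtain ⟨d, hd⟩ : ∃ d, S.wron σ d (S.jostAt ω σ) 0 ≠ 0 := ⟨_, S.jostAt_wron_ne_zero h0 hω.le σ⟩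
  have hwron : Tendsto (fun w => S.wron σ d (S.jostAt w σ) 0) (𝓝[D] ω)
      (𝓝 (S.wron σ d (S.jostAt ω σ) 0)) :=
    (((hj σ 1).const_mul _).sub ((hj σ 0).const_mul _)).const_mul _
  -- The initial values of the growing solution converge at `ω`, although `|θ_σ(ω)| = 1` and there
  -- is no growth there.
  have hfac : Tendsto (fun w => S.bLim σ * (S.theta σ w ^ 2 - 1) /
      (S.wron σ d (S.jostAt w σ) 0 * S.theta σ w)) (𝓝[D] ω)
      (𝓝 (S.bLim σ * (S.theta σ ω ^ 2 - 1) / (S.wron σ d (S.jostAt ω σ) 0 * S.theta σ ω))) :=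
    (((hθ.pow 2).sub_const 1).const_mul _).div (hwron.mul hθ) (mul_ne_zero hd hθ0)
  have hex : ∀ᶠ w in 𝓝[D] ω, ∃ p : (ℕ → ℂ) × (S.center → ℂ),
      (∀ k ≤ 1, p.1 k = S.bLim σ * (S.theta σ w ^ 2 - 1) /
        (S.wron σ d (S.jostAt w σ) 0 * S.theta σ w) * d k) ∧
      S.centerMap (S.jostAt w) (S.W w) p.2 = -S.source σ p.1 (S.W w) ∧
      S.IsSpecialSolution σ w (S.channelFn σ p.1 + S.extend (S.jostAt w) p.2)
        (fun γ => p.2 (S.port γ)) := by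
    filter_upwards [self_mem_nhdsWithin, hwron.eventually_ne hd] with w hw hdw
    have hw0 := norm_pos_iff.1 hw.1
    have hθ1 := S.norm_theta_lt_one σ hw0 hw.2.1
    obtain ⟨x, hx, hx1, hx2⟩ := S.exists_growing hw0 hw.2.1.le σ hθ1 hdw
    obtain ⟨v, hv⟩ := LinearMap.injective_iff_surjective.1
      (S.centerMap_injective hw0 hw.2.1.le hw.2.2) (-S.source σ x (S.W w))
    exact ⟨(x, v), hx2, hv, isSpecialSolution_add hw0 hw.2.1.le hx hv
      (fun h => absurd h hθ1.ne) fun _ => hx1⟩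
  have : Nonempty C := ⟨σ⟩
  have := S.neBot_regular hω
  obtain ⟨p, hp⟩ := hex.choice
  -- the outgoing solutions at the boundary point
  set K := LinearMap.ker (S.centerMap (S.jostAt ω) (S.W ω)) with hK
  have hKopen : ∀ u ∈ K, ∀ γ, ‖S.theta γ ω‖ = 1 → u (S.port γ) = 0 := fun u hu γ hγ =>
    S.coeff_eq_zero_of_open hω he
      (S.isSolution_extend (fun γ => S.isChanSol_jostAt h0 hω.le γ) hu)
      (c := fun γ => u (S.port γ)) (fun γ k => S.extend_chan _ u γ k) hγ
  -- The map `q` is a projection onto the kernel, so the images `u i` of the unit vectors span it.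
  obtain ⟨q, hq⟩ := K.subtype.exists_leftInverse_of_injective (by simp)
  set u : S.center → S.center → ℂ := fun i => q (Pi.single i 1) with hu
  have huK : ∀ i, u i ∈ K := fun i => (q (Pi.single i 1)).2
  -- Stated through submodules because the pairing is antilinear in `u`; it is applied to
  -- `jostOrthogonal`.
  have hspan : ∀ v ∈ K, ∀ N : Submodule ℂ (S.center → ℂ), (∀ i, u i ∈ N) → v ∈ N := by
    intro v hv N hN
    have h1 : q v = ⟨v, hv⟩ := LinearMap.congr_fun hq ⟨v, hv⟩
    have h2 : v = ∑ i, v i • u i := by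
      have h3 := congrArg Subtype.val h1
      rw [LinearMap.pi_apply_eq_sum_univ q v] at h3
      refine h3.symm.trans ?_
      simp only [hu, Submodule.coe_sum, Submodule.coe_smul]
      refine Finset.sum_congr rfl fun i _ => ?_
      congr 4
      funext j
      simp [Pi.single_apply, eq_comm]
    rw [h2]
    exact N.sum_mem fun i _ => N.smul_mem _ (hN i)
  -- A vector killed by the enlarged system lies in `K` and is orthogonal to all of `K`, hence to
  -- itself.
  have hinj : Function.Injective ((S.centerMap (S.jostAt ω) (S.W ω)).prod
      (LinearMap.pi fun i => S.jostPairing (S.jostAt ω) (S.jostAt ω) (u i))) := by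
    rw [← LinearMap.ker_eq_bot, LinearMap.ker_eq_bot']
    intro v hv
    have hv1 : v ∈ K := congrArg Prod.fst hv
    have hv2 : ∀ i, S.jostPairing (S.jostAt ω) (S.jostAt ω) (u i) v = 0 := fun i =>
      congrFun (congrArg Prod.snd hv) i
    have hv3 : S.jostPairing (S.jostAt ω) (S.jostAt ω) v v = 0 :=
      hspan v hv1 (S.jostOrthogonal (S.jostAt ω) (S.jostAt ω) v) hv2
    rw [jostPairing_eq_pairing] at hv3
    refine S.eq_zero_of_extend_eq_zero (fun γ => S.jostAt_ne_zero h0 hω.le γ)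
      (S.eq_zero_of_pairing_conj (fun γ => ?_) hv3)
    rcases (S.norm_theta_le γ h0 hω.le).lt_or_eq with hγ | hγ
    · obtain ⟨B, hB, hb⟩ := S.exists_jostAt_bound γ
      refine ((S.summable_norm_jostAt γ h0 hω.le hγ).mul_left
        (Complex.normSq (v (S.port γ)) * B)).of_nonneg_of_le (fun _ => Complex.normSq_nonneg _)
        fun k => ?_
      rw [extend_chan, Complex.normSq_mul, Complex.normSq_eq_norm_sq (S.jostAt ω γ (k + 1)), sq,
        mul_assoc]
      have hn := Complex.normSq_nonneg (v (S.port γ))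
      gcongr
      refine (hb ω (k + 1) h0 hω.le).trans (mul_le_of_le_one_right hB ?_)
      exact pow_le_one₀ (norm_nonneg _) (S.norm_theta_le γ h0 hω.le)
    · simp only [extend_chan, hKopen v hv1 γ hγ, zero_mul, map_zero]
      exact summable_zero
  obtain ⟨v₀, hv₀⟩ := exists_tendsto_of_injective (l := 𝓝[D] ω) hinj
    (T := fun w => (S.centerMap (S.jostAt w) (S.W w)).prod
      (LinearMap.pi fun i => S.jostPairing (S.jostAt w) (S.jostAt ω) (u i)))
    (v := fun w => (p w).2) (F := fun w => (-S.source σ (p w).1 (S.W w), 0))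
    (F₀ := (-S.source σ (fun k => S.bLim σ * (S.theta σ ω ^ 2 - 1) /
        (S.wron σ d (S.jostAt ω σ) 0 * S.theta σ ω) * d k) (S.W ω), 0))
    (fun v => (S.tendsto_centerMap hj hW v).prodMk_nhds (tendsto_pi_nhds.2 fun i =>
      S.tendsto_jostPairing hω (hKopen _ (huK i)) hl v))
    (by
      filter_upwards [self_mem_nhdsWithin, hp] with w hw hpw
      refine Prod.ext hpw.2.1 (funext fun i => ?_)
      exact S.jostPairing_eq_zero hω (hKopen _ (huK i)) (huK i) hσ (norm_pos_iff.1 hw.1) hw.2.1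
        hpw.2.2.solution)
    ((S.tendsto_source σ (fun k hk => ((hfac.mul_const (d k)).congr' (by
      filter_upwards [hp] with w hpw using (hpw.1 k hk).symm))) hW).neg.prodMk_nhds
      tendsto_const_nhds)
  refine ⟨v₀ (S.port ν), ((tendsto_pi_nhds.1 hv₀) (S.port ν)).congr' ?_⟩
  filter_upwards [self_mem_nhdsWithin, hp] with w hw hpw
  exact (hpw.2.2.regularCoeff_eq hσν (norm_pos_iff.1 hw.1) hw.2.1.le hw.2.2).symm

/-- Reciprocity of the scattering coefficients in the open disk. -/
theorem regularCoeff_reciprocity [Finite C] {σ ν : C} (hσν : σ ≠ ν) {w : ℂ} (h0 : w ≠ 0)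
    (hw : ‖w‖ < 1) (hreg : S.IsRegular w) :
    S.regularCoeff ν σ w * (S.bLim ν * (S.theta ν w - (S.theta ν w)⁻¹)) =
      S.regularCoeff σ ν w * (S.bLim σ * (S.theta σ w - (S.theta σ w)⁻¹)) := by
  have := Fintype.ofFinite C
  obtain ⟨ψ, s, h⟩ := exists_isSpecialSolution σ h0 hw.le hreg
  obtain ⟨φ, t, h'⟩ := exists_isSpecialSolution ν h0 hw.le hreg
  rw [h.regularCoeff_eq hσν h0 hw.le hreg, h'.regularCoeff_eq hσν.symm h0 hw.le hreg]
  have hg := S.green h.solution h'.solution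
  have hconst : ∀ γ l, Tendsto (S.wron γ (fun k => ψ (S.chan γ k)) (fun k => φ (S.chan γ k)))
      atTop (𝓝 l) → S.wron γ (fun k => ψ (S.chan γ k)) (fun k => φ (S.chan γ k)) 0 = l :=
    fun γ l hl => tendsto_nhds_unique tendsto_const_nhds
      (hl.congr fun k => (h.solution.chan γ).wron_eq (h'.solution.chan γ) k)
  have hout : ∀ γ (c : ℂ) (ξ : A → ℂ), (∀ k, ξ (S.chan γ k) = c * S.jost γ k (S.theta γ w)) →
      Tendsto (fun k => ξ (S.chan γ k) / S.theta γ w ^ k) atTop (𝓝 c) := by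
    intro γ c ξ hξ
    have := (S.isJost_jostAt h0 hw.le γ).2.const_mul c
    rw [mul_one] at this
    refine this.congr fun k => ?_
    rw [hξ k, mul_div_assoc]
    rfl
  have hθσ := S.theta_ne_zero σ h0 hw.le
  have hθν := S.theta_ne_zero ν h0 hw.le
  have h1 := hconst σ _ (tendsto_wron (inv_ne_zero hθσ) (mul_inv_cancel₀ hθσ)
    (h.growing (S.norm_theta_lt_one σ h0 hw)) (hout σ _ φ (h'.outgoing σ hσν)))
  have h2 := hconst ν _ (tendsto_wron hθν (inv_mul_cancel₀ hθν)
    (hout ν _ ψ (h.outgoing ν hσν.symm)) (h'.growing (S.norm_theta_lt_one ν h0 hw)))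
  -- On every other channel both solutions are multiples of the same Jost solution, so only `σ` and
  -- `ν` contribute.
  rw [sub_self, zero_mul, Finset.sum_eq_add σ ν hσν, h1, h2] at hg
  · linear_combination hg
  · rintro γ - ⟨hγσ, hγν⟩
    simp only [wron, h.outgoing γ hγσ, h'.outgoing γ hγν]
    ring
  · intro hn
    exact absurd (Finset.mem_univ _) hn
  · intro hn
    exact absurd (Finset.mem_univ _) hn

/-- Reciprocity expresses `s_{νσ}` through `s_{σν}`, whose limit exists because `ν` is open. The
divisor `b_ν (θ_ν - θ_ν⁻¹)` stays nonzero at `ω` because `W ω` is not a band edge. -/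
theorem exists_tendsto_regularCoeff_of_open_right [Finite C] {σ ν : C} (hσν : σ ≠ ν) {ω : ℂ}
    (hω : ‖ω‖ = 1) (he : ¬ S.IsBandEdge ω) (hν : ‖S.theta ν ω‖ = 1) :
    ∃ z, Tendsto (S.regularCoeff ν σ)
      (𝓝[{w | 0 < ‖w‖ ∧ ‖w‖ < 1 ∧ S.IsRegular w}] ω) (𝓝 z) := by
  have h0 : ω ≠ 0 := by rintro rfl; simp at hω
  obtain ⟨z, hz⟩ := S.exists_tendsto_regularCoeff hσν.symm hω he hν
  set D : Set ℂ := {w | 0 < ‖w‖ ∧ ‖w‖ < 1 ∧ S.IsRegular w} with hD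
  have hl : 𝓝[D] ω ≤ 𝓝[{w | w ≠ 0 ∧ ‖w‖ ≤ 1}] ω :=
    nhdsWithin_mono _ fun w hw => ⟨norm_pos_iff.1 hw.1, hw.2.1.le⟩
  have hθ : ∀ γ, Tendsto (fun w => S.bLim γ * (S.theta γ w - (S.theta γ w)⁻¹)) (𝓝[D] ω)
      (𝓝 (S.bLim γ * (S.theta γ ω - (S.theta γ ω)⁻¹))) := by
    intro γ
    have h1 : Tendsto (S.theta γ) (𝓝[D] ω) (𝓝 (S.theta γ ω)) :=
      (S.continuousOn_theta γ ω ⟨h0, hω.le⟩).mono_left hl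
    exact (h1.sub (h1.inv₀ (S.theta_ne_zero γ h0 hω.le))).const_mul _
  have hne : (S.bLim ν : ℂ) * (S.theta ν ω - (S.theta ν ω)⁻¹) ≠ 0 := by
    refine mul_ne_zero (S.bLim_ne_zero ν) fun h => S.theta_sq_ne_one ν h0 hω.le he ?_
    have := S.theta_ne_zero ν h0 hω.le
    field_simp at h
    linear_combination h
  refine ⟨_, ((hz.mul (hθ σ)).div (hθ ν) hne).congr' ?_⟩
  filter_upwards [self_mem_nhdsWithin, (hθ ν).eventually_ne hne] with w hw hw'
  rw [Pi.div_apply, div_eq_iff hw']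
  exact (S.regularCoeff_reciprocity hσν (norm_pos_iff.1 hw.1) hw.2.1 hw.2.2).symm

end WebSystem

/-! ### The corollary -/

theorem mainTheorem6 {A C : Type*} [Finite C] (S : WebSystem A C) (σ ν : C) (hσν : σ ≠ ν)
    (ω : ℂ) (hω : ω ∈ S.Tplus σ ∪ S.Tplus ν) :
    (S.IsRegular ω ∨ ¬ S.IsBandEdge ω → ∃! z, S.IsScatteringCoeff ν σ ω z) ∧
    S.scattering ν σ ω⁻¹ = (starRingEnd ℂ) (S.scattering ν σ ω) ∧
    ((‖S.scattering ν σ ω‖ ^ 2 : ℝ) : ℂ) = S.scattering ν σ ω * S.scattering ν σ ω⁻¹ := by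
  have hn : ‖ω‖ = 1 := by rcases hω with h | h <;> exact h.1
  have h0 : ω ≠ 0 := by rintro rfl; simp at hn
  have hinv : S.scattering ν σ ω⁻¹ = (starRingEnd ℂ) (S.scattering ν σ ω) := by
    rw [← WebSystem.conj_eq_inv_of_norm_eq_one hn, WebSystem.scattering_conj hσν hn]
  refine ⟨fun h => ?_, hinv, ?_⟩
  · suffices hex : ∃ z, S.IsScatteringCoeff ν σ ω z by
      obtain ⟨z, hz⟩ := hex
      exact ⟨z, hz, fun y hy => hy.unique hσν hn hz⟩
    by_cases hr : S.IsRegular ω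
    · obtain ⟨ψ, s, hs⟩ := WebSystem.exists_isSpecialSolution σ h0 hn.le hr
      exact ⟨s ν, Or.inl ⟨hr, ψ, s, hs, rfl⟩⟩
    · have he := h.resolve_left hr
      rcases hω with h1 | h1
      · obtain ⟨z, hz⟩ := S.exists_tendsto_regularCoeff hσν hn he h1.2
        exact ⟨z, Or.inr ⟨hr, hz⟩⟩
      · obtain ⟨z, hz⟩ := S.exists_tendsto_regularCoeff_of_open_right hσν hn he h1.2
        exact ⟨z, Or.inr ⟨hr, hz⟩⟩
  · rw [hinv, Complex.mul_conj, Complex.normSq_eq_norm_sq]
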